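/- Let $\lambda>0$, $\mathbb{R}_+=(0,\infty)$, $dm_\lambda(x)=x^{2\lambda}\,dx$ on $\mathbb{R}_+$, and let $\mu_\lambda=m_\lambda\times m_\lambda$ on $\mathbb{R}_+\times\mathbb{R}_+$; write $\mathbb{R}_\lambda=(\mathbb{R}_+\times\mathbb{R}_+,\mu_\lambda)$. A rectangle is a set $R=I_1\times I_2$, where $I_1,I_2$ are intervals of the form $(x-t,x+t)\cap\mathbb{R}_+$ with $x,t>0$. For $q\in(1,\infty]$, a $q$-atom is a function $a\in L^q(\mathbb{R}_\lambda)$, complex valued, supported on a rectangle $R$, with $\|a\|_{L^q(\mathbb{R}_\lambda)}\le\mu_\lambda(R)^{1/q-1}$ and $\int_{\mathbb{R}_+\times\mathbb{R}_+}a\,d\mu_\lambda=0$. The space $h^{1,q}(\mathbb{R}_\lambda)$ consists of all $f=\sum_i\alpha_ia_i$ (convergence in $L^1(\mathbb{R}_\lambda)$) with $q$-atoms $a_i$ and $\alpha_i\in\mathbb{C}$, $\sum_i|\alpha_i|<\infty$, and $\|f\|_{h^{1,q}(\mathbb{R}_\lambda)}=\inf\sum_i|\alpha_i|$, the infimum being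 taken over all such decompositions of $f$. Theorem. Let $q\in(1,\infty)$. Then $h^{1,q}(\mathbb{R}_\lambda)=h^{1,\infty}(\mathbb{R}_\lambda)$ with equivalent norms: there are constants $c,C>0$, depending only on $\lambda$ and $q$, such that $c\,\|f\|_{h^{1,\infty}(\mathbb{R}_\lambda)}\le\|f\|_{h^{1,q}(\mathbb{R}_\lambda)}\le C\,\|f\|_{h^{1,\infty}(\mathbb{R}_\lambda)}$ for all $f$ in this space. -/

import Mathlib

open MeasureTheory Set Filter Topology
open scoped ENNReal

noncomputable section

namespace Bessel

/-- The measure `dm_lam(x) = x ^ (2 * lam) dx` on `ℝ₊ = (0, ∞)`, as a measure on `ℝ` which does not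
charge the complement of `(0, ∞)`. -/
def measure (lam : ℝ) : Measure ℝ :=
  (volume.restrict (Ioi (0 : ℝ))).withDensity fun x => ENNReal.ofReal (x ^ (2 * lam))

/-- The product measure `dμ_lam(x₁, x₂) = dm_lam(x₁) × dm_lam(x₂)` on `ℝ₊ × ℝ₊`. -/
def prodMeasure (lam : ℝ) : Measure (ℝ × ℝ) :=
  (measure lam).prod (measure lam)

/-- The interval `I(x, t) = (x - t, x + t) ∩ ℝ₊`. -/
def interval (x t : ℝ) : Set ℝ :=
  Ioo (x - t) (x + t) ∩ Ioi 0

/-- A rectangle in `ℝ₊ × ℝ₊`: a product of two intervals `I(x₁, t₁) × I(x₂, t₂)` with centres in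
`ℝ₊` and positive radii. -/
def IsRectangle (R : Set (ℝ × ℝ)) : Prop :=
  ∃ x₁ t₁ x₂ t₂ : ℝ, 0 < x₁ ∧ 0 < t₁ ∧ 0 < x₂ ∧ 0 < t₂ ∧ R = interval x₁ t₁ ×ˢ interval x₂ t₂

/-- A `q`-atom: a function in `L^q(μ_lam)` which vanishes (almost everywhere) outside a rectangle
`R`, with `‖a‖_q ≤ μ_lam(R) ^ (1 / q - 1)` and `∫ a dμ_lam = 0`.
For `q = ∞` the exponent is `-1`. -/
def IsAtom (lam : ℝ) (q : ℝ≥0∞) (a : ℝ × ℝ → ℂ) : Prop :=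
  MemLp a q (prodMeasure lam) ∧
  (∃ R : Set (ℝ × ℝ), IsRectangle R ∧
    (∀ᵐ x ∂(prodMeasure lam), x ∉ R → a x = 0) ∧
    eLpNorm a q (prodMeasure lam) ≤ prodMeasure lam R ^ ((q⁻¹).toReal - 1)) ∧
  ∫ x, a x ∂(prodMeasure lam) = 0

/-- `f = ∑ i, α i • a i` is an atomic decomposition: the `a i` are `q`-atoms, `∑ i, |α i| < ∞`, and
the series converges to `f` in `L¹(μ_lam)`. -/
def IsAtomicDecomposition (lam : ℝ) (q : ℝ≥0∞) (f : Lp ℂ 1 (prodMeasure lam))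
    (α : ℕ → ℂ) (a : ℕ → ℝ × ℝ → ℂ) : Prop :=
  (∀ i, IsAtom lam q (a i)) ∧
  (Summable fun i => ‖α i‖) ∧
  Tendsto (fun n => eLpNorm (fun x => f x - ∑ i ∈ Finset.range n, α i * a i x) 1 (prodMeasure lam))
    atTop (𝓝 0)

/-- The atomic little Hardy space `h^{1,q}`, whose elements are classes of functions modulo equality
almost everywhere. -/
def littleHardy (lam : ℝ) (q : ℝ≥0∞) : Set (Lp ℂ 1 (prodMeasure lam)) :=
  {f | ∃ α a, IsAtomicDecomposition lam q f α a}

/-- The norm of `h^{1,q}`: the infimum of `∑ i, |α i|` over all atomic decompositions. -/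
def littleHardyNorm (lam : ℝ) (q : ℝ≥0∞) (f : Lp ℂ 1 (prodMeasure lam)) : ℝ :=
  sInf {s : ℝ | ∃ α a, IsAtomicDecomposition lam q f α a ∧ s = ∑' i, ‖α i‖}

end Bessel

end

/-! A bounded atom is a `q`-atom on the same rectangle by Hölder's inequality, so only the
decomposition of a `q`-atom `a` on a rectangle `R` into bounded atoms matters. A rectangle carries
its own dyadic grid: the distribution function of the normalised measure on each side maps it,
measure preservingly, onto the unit interval, and the preimages of the dyadic squares are rectangles
of equal mass, each a quarter of its parent, to which Lebesgue's differentiation theorem carries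
over. Stop at the maximal cells on which the `L^q` average of `a` exceeds a large multiple of
`1 / μ R`. Replacing `a` on these cells by its means leaves a multiple of a bounded atom on `R`, and
the error is a sum of multiples of `q`-atoms on the stopping cells. Since `q > 1`, these cells are
so small that the coefficients in the error add up to at most `1 / 2`, and iterating yields a
geometric series. -/

noncomputable section

namespace Hardy

section Synthesis

variable {𝕜 E ι : Type*} [NontriviallyNormedField 𝕜] [NormedAddCommGroup E] [NormedSpace 𝕜 E]

lemma summable_norm_of_lp_one (x : lp (fun _ : ι => 𝕜) 1) : Summable fun i => ‖x i‖ := by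
  simpa using (lp.memℓp x).summable (by simp)

lemma norm_eq_tsum_norm_of_lp_one (x : lp (fun _ : ι => 𝕜) 1) : ‖x‖ = ∑' i, ‖x i‖ := by
  simpa using lp.norm_eq_tsum_rpow (by simp) x

lemma summable_norm_smul_of_lp_one {K : ℝ} {v : ι → E} (hv : ∀ i, ‖v i‖ ≤ K)
    (x : lp (fun _ : ι => 𝕜) 1) : Summable fun i => ‖x i • v i‖ :=
  ((summable_norm_of_lp_one x).mul_right K).of_nonneg_of_le (fun _ => norm_nonneg _) fun i =>
    (norm_smul_le _ _).trans (by gcongr; exact hv i)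

lemma norm_tsum_smul_le_of_lp_one {K : ℝ} {v : ι → E} (hv : ∀ i, ‖v i‖ ≤ K)
    (x : lp (fun _ : ι => 𝕜) 1) : ‖∑' i, x i • v i‖ ≤ K * ‖x‖ := by
  rw [norm_eq_tsum_norm_of_lp_one]
  refine tsum_of_norm_bounded ((summable_norm_of_lp_one x).hasSum.mul_left K) fun i => ?_
  rw [norm_smul, mul_comm]
  gcongr
  exact hv i

variable [CompleteSpace E]

/-- The bounded operator `x ↦ ∑' i, x i • v i` on `ℓ¹(ι)` attached to a bounded family `v`, through
which atomic sums become values of an operator. -/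
def synthesis {K : ℝ} (v : ι → E) (hv : ∀ i, ‖v i‖ ≤ K) : lp (fun _ : ι => 𝕜) 1 →L[𝕜] E :=
  LinearMap.mkContinuous
    { toFun := fun x => ∑' i, x i • v i
      map_add' := fun x y => by
        simpa [add_smul] using (summable_norm_smul_of_lp_one hv x).of_norm.tsum_add
          (summable_norm_smul_of_lp_one hv y).of_norm
      map_smul' := fun z x => by
        simpa [mul_smul] using (summable_norm_smul_of_lp_one hv x).of_norm.tsum_const_smul z }
    K (norm_tsum_smul_le_of_lp_one hv)

variable {K : ℝ} {v : ι → E} {hv : ∀ i, ‖v i‖ ≤ K}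

lemma hasSum_synthesis (x : lp (fun _ : ι => 𝕜) 1) :
    HasSum (fun i => x i • v i) (synthesis v hv x) :=
  (summable_norm_smul_of_lp_one hv x).of_norm.hasSum

lemma norm_synthesis_le (hK : 0 ≤ K) : ‖synthesis (𝕜 := 𝕜) v hv‖ ≤ K :=
  LinearMap.mkContinuous_norm_le _ hK (norm_tsum_smul_le_of_lp_one hv)

lemma synthesis_single [DecidableEq ι] (i : ι) (z : 𝕜) :
    synthesis v hv (lp.single 1 i z) = z • v i := by
  refine (hasSum_synthesis _).unique ?_
  convert hasSum_single i fun j hj => ?_ using 1 <;> simp_all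

end Synthesis

section AtomicSum

variable {𝕜 E ι : Type*} [NontriviallyNormedField 𝕜] [NormedAddCommGroup E] [NormedSpace 𝕜 E]

variable (𝕜) in
/-- `f` is the sum of a series of multiples of elements of `S` whose coefficients have `ℓ¹` norm at
most `c`. The coefficients are indexed by `S` itself rather than by `ℕ`. -/
def IsAtomicSum (S : Set E) (c : ℝ) (f : E) : Prop :=
  ∃ x : lp (fun _ : S => 𝕜) 1, ‖x‖ ≤ c ∧ HasSum (fun u : S => x u • (u : E)) f

variable {S T : Set E} {K c c' C θ : ℝ} {f g : E}

lemma isAtomicSum_iff_exists_synthesis [CompleteSpace E] (hS : ∀ u : S, ‖(u : E)‖ ≤ K) :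
    IsAtomicSum 𝕜 S c f ↔
      ∃ x : lp (fun _ : S => 𝕜) 1, ‖x‖ ≤ c ∧ synthesis (fun u : S => (u : E)) hS x = f :=
  exists_congr fun x => and_congr_right fun _ =>
    ⟨fun h => (hasSum_synthesis x).unique h, fun h => h ▸ hasSum_synthesis x⟩

lemma IsAtomicSum.of_le (h : IsAtomicSum 𝕜 S c f) (hc : c ≤ c') : IsAtomicSum 𝕜 S c' f :=
  let ⟨x, hx, hf⟩ := h
  ⟨x, hx.trans hc, hf⟩

lemma isAtomicSum_zero : IsAtomicSum 𝕜 S 0 0 :=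
  ⟨0, by simp, by simp⟩

lemma isAtomicSum_smul_mem (hf : f ∈ S) (z : 𝕜) : IsAtomicSum 𝕜 S ‖z‖ (z • f) := by
  classical
  refine ⟨lp.single 1 ⟨f, hf⟩ z, (lp.norm_single (by simp) _ _).le, ?_⟩
  convert hasSum_single (⟨f, hf⟩ : S) fun u hu => ?_ using 1 <;> simp_all

lemma IsAtomicSum.of_hasSum [CompleteSpace 𝕜] [CompleteSpace E] (hS : ∀ u ∈ S, ‖u‖ ≤ K)
    {c : ι → ℝ} {f : ι → E} (hf : ∀ i, IsAtomicSum 𝕜 S (c i) (f i)) (hc : Summable c)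
    (hg : HasSum f g) : IsAtomicSum 𝕜 S (∑' i, c i) g := by
  simp only [isAtomicSum_iff_exists_synthesis fun u : S => hS u u.2] at hf ⊢
  choose x hxc hxf using hf
  have hx : Summable x := hc.of_norm_bounded hxc
  refine ⟨∑' i, x i, tsum_of_norm_bounded hc.hasSum hxc, ?_⟩
  rw [ContinuousLinearMap.map_tsum _ hx]
  simpa only [hxf] using hg.tsum_eq

lemma IsAtomicSum.mono [CompleteSpace 𝕜] [CompleteSpace E] (hT : ∀ u ∈ T, ‖u‖ ≤ K) (hST : S ⊆ T)
    (h : IsAtomicSum 𝕜 S c f) : IsAtomicSum 𝕜 T c f := by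
  obtain ⟨x, hx, hf⟩ := h
  exact (IsAtomicSum.of_hasSum hT (fun u : S => isAtomicSum_smul_mem (hST u.2) (x u))
    (summable_norm_of_lp_one x) hf).of_le (norm_eq_tsum_norm_of_lp_one x ▸ hx)

lemma isAtomicSum_iff_exists_nat [CompleteSpace 𝕜] [CompleteSpace E] (hS : ∀ u ∈ S, ‖u‖ ≤ K)
    (hne : S.Nonempty) :
    IsAtomicSum 𝕜 S c f ↔ ∃ (α : ℕ → 𝕜) (u : ℕ → E), (∀ i, u i ∈ S) ∧ (Summable fun i => ‖α i‖) ∧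
      ∑' i, ‖α i‖ ≤ c ∧ HasSum (fun i => α i • u i) f := by
  constructor
  · rintro ⟨x, hx, hf⟩
    obtain ⟨u₀, hu₀⟩ := hne
    obtain ⟨e, he⟩ := Set.countable_iff_exists_injective.1
      (summable_norm_of_lp_one x).of_norm.countable_support
    let α : ℕ → 𝕜 := Function.extend e (fun s => x s) 0
    let u : ℕ → S := Function.extend e (fun s => (s : S)) fun _ => ⟨u₀, hu₀⟩
    have hα : HasSum (fun i => ‖α i‖) (∑' s, ‖x s‖) := by
      convert (hasSum_extend_zero he).2 ((hasSum_subtype_iff_of_support_subset (by simp)).2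
        (summable_norm_of_lp_one x).hasSum) using 1
      ext i
      by_cases hi : ∃ s, e s = i
      · obtain ⟨s, rfl⟩ := hi
        simp [α, he.extend_apply]
      · simp [α, hi]
    have hsupp : Function.support (fun s : S => x s • (s : E)) ⊆ Function.support x :=
      fun s hs => left_ne_zero_of_smul hs
    have hαu : HasSum (fun i => α i • (u i : E)) f := by
      convert (hasSum_extend_zero he).2 ((hasSum_subtype_iff_of_support_subset hsupp).2 hf) using 1
      ext i
      by_cases hi : ∃ s, e s = i
      · obtain ⟨s, rfl⟩ := hi
        simp [α, u, he.extend_apply]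
      · simp [α, hi]
    exact ⟨α, fun i => u i, fun i => (u i).2, hα.summable,
      hα.tsum_eq.trans_le (norm_eq_tsum_norm_of_lp_one x ▸ hx), hαu⟩
  · rintro ⟨α, u, hu, hα, hc, hf⟩
    exact (IsAtomicSum.of_hasSum hS (fun i => isAtomicSum_smul_mem (hu i) (α i)) hα hf).of_le hc

/-- Neumann series: on `ℓ¹(S)` the synthesis operators satisfy `A_S = A_T ∘ P + A_S ∘ Q` with
`‖P‖ ≤ C` and `‖Q‖ ≤ θ < 1`, hence `A_S = A_T ∘ P ∘ (1 - Q)⁻¹`. -/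
lemma IsAtomicSum.of_approx [CompleteSpace 𝕜] [CompleteSpace E] (hS : ∀ u ∈ S, ‖u‖ ≤ K)
    (hT : ∀ u ∈ T, ‖u‖ ≤ K) (hC : 0 ≤ C) (hθ : 0 ≤ θ) (hθ' : θ < 1)
    (hST : ∀ u ∈ S, ∃ g, IsAtomicSum 𝕜 T C g ∧ IsAtomicSum 𝕜 S θ (u - g))
    (hf : IsAtomicSum 𝕜 S c f) : IsAtomicSum 𝕜 T (C * (c / (1 - θ))) f := by
  classical
  simp only [isAtomicSum_iff_exists_synthesis fun u : S => hS u u.2,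
    isAtomicSum_iff_exists_synthesis fun u : T => hT u u.2] at hf hST ⊢
  set A_S := synthesis (𝕜 := 𝕜) (fun u : S => (u : E)) fun u => hS u u.2
  set A_T := synthesis (𝕜 := 𝕜) (fun u : T => (u : E)) fun u => hT u u.2
  choose g p q using fun u : S => hST u u.2
  choose p hpC hpg using p
  choose q hqθ hqu using q
  set P := synthesis (𝕜 := 𝕜) p hpC
  set Q := synthesis (𝕜 := 𝕜) q hqθ
  have factorization : A_S = A_T ∘L P + A_S ∘L Q := by
    refine lp.ext_continuousLinearMap (by simp) fun u => ?_
    ext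
    simp [A_S, A_T, P, Q, synthesis_single, hpg, hqu]
  have hQ : ‖Q‖ ≤ θ := norm_synthesis_le hθ
  obtain ⟨R, hR⟩ := isUnit_one_sub_of_norm_lt_one (hQ.trans_lt hθ')
  obtain ⟨x, hxc, rfl⟩ := hf
  obtain ⟨y, rfl⟩ : ∃ y, y - Q y = x := by
    refine ⟨R.inv x, ?_⟩
    simpa [hR] using DFunLike.congr_fun R.val_inv x
  have hy : ‖y‖ ≤ c / (1 - θ) := by
    rw [le_div_iff₀ (by linarith)]
    have := norm_sub_norm_le y (Q y)
    have := Q.le_of_opNorm_le hQ y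
    linarith
  refine ⟨P y, (P.le_of_opNorm_le (norm_synthesis_le hC) y).trans (by gcongr), ?_⟩
  rw [map_sub]
  nth_rewrite 1 [factorization]
  simp

end AtomicSum

section Atom
open scoped ProbabilityTheory NNReal

variable {X F : Type*} [MeasurableSpace X] {ν : Measure X} {E E' : Set X}
  [NormedAddCommGroup F] {p q : ℝ≥0∞} {κ κ' : ℝ≥0} {a a' f : X → F}

/-- The measurable sets of positive finite measure: those over which one can average. -/
structure IsAveragingSet (ν : Measure X) (E : Set X) : Prop where
  measurableSet : MeasurableSet E
  measure_ne_zero : ν E ≠ 0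
  measure_ne_top : ν E ≠ ∞

lemma IsAveragingSet.measureReal_ne_zero (hE : IsAveragingSet ν E) : ν.real E ≠ 0 :=
  ENNReal.toReal_ne_zero.2 ⟨hE.measure_ne_zero, hE.measure_ne_top⟩

lemma IsAveragingSet.isProbabilityMeasure_cond (hE : IsAveragingSet ν E) :
    IsProbabilityMeasure ν[|E] :=
  ProbabilityTheory.cond_isProbabilityMeasure_of_finite hE.measure_ne_zero hE.measure_ne_top

lemma cond_congr_set (h : E =ᵐ[ν] E') : ν[|E] = ν[|E'] := by
  simp only [ProbabilityTheory.cond, measure_congr h, Measure.restrict_congr_set h]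

lemma eLpNorm_cond (hE : IsAveragingSet ν E) (q : ℝ≥0∞) (f : X → F) :
    eLpNorm f q ν[|E] = (ν E)⁻¹ ^ q⁻¹.toReal * eLpNorm f q (ν.restrict E) := by
  rw [ProbabilityTheory.cond,
    eLpNorm_smul_measure_of_ne_zero (ENNReal.inv_ne_zero.2 hE.measure_ne_top), smul_eq_mul, one_div]

lemma eLpNorm_restrict_of_ae_eq_zero (hE : MeasurableSet E) (h : ∀ᵐ x ∂ν, x ∉ E → a x = 0) :
    eLpNorm a q (ν.restrict E) = eLpNorm a q ν := by
  rw [← eLpNorm_indicator_eq_eLpNorm_restrict hE]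
  refine eLpNorm_congr_ae ?_
  filter_upwards [h] with x hx
  by_cases hxE : x ∈ E
  · simp [hxE]
  · simp [hxE, hx hxE]

variable [NormedSpace ℝ F]

/-- A function `a` of mean zero which vanishes off `E` and whose normalised `L^q` norm over `E` is
at most `κ`. A `q`-atom on `E` is the case `κ = (ν E)⁻¹`; measuring heights with the probability
measure `ν[|E]` makes the bound independent of the exponent. -/
structure IsAtomOfHeight (ν : Measure X) (q : ℝ≥0∞) (E : Set X) (κ : ℝ≥0) (a : X → F) : Prop where
  aestronglyMeasurable : AEStronglyMeasurable a ν
  ae_eq_zero_of_notMem : ∀ᵐ x ∂ν, x ∉ E → a x = 0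
  eLpNorm_cond_le : eLpNorm a q ν[|E] ≤ κ
  integral_eq_zero : ∫ x, a x ∂ν = 0

namespace IsAtomOfHeight

lemma congr (h : IsAtomOfHeight ν q E κ a) (ha : a =ᵐ[ν] a') : IsAtomOfHeight ν q E κ a' where
  aestronglyMeasurable := h.aestronglyMeasurable.congr ha
  ae_eq_zero_of_notMem := by
    filter_upwards [h.ae_eq_zero_of_notMem, ha] with x hx hax
    rwa [← hax]
  eLpNorm_cond_le := by
    rw [← eLpNorm_congr_ae (ProbabilityTheory.cond_absolutelyContinuous.ae_le ha)]
    exact h.eLpNorm_cond_le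
  integral_eq_zero := integral_congr_ae ha ▸ h.integral_eq_zero

lemma congr_set (h : IsAtomOfHeight ν q E κ a) (hE : E =ᵐ[ν] E') : IsAtomOfHeight ν q E' κ a where
  aestronglyMeasurable := h.aestronglyMeasurable
  ae_eq_zero_of_notMem := by
    filter_upwards [h.ae_eq_zero_of_notMem, hE.mem_iff] with x hx hxE
    rwa [← hxE]
  eLpNorm_cond_le := cond_congr_set hE ▸ h.eLpNorm_cond_le
  integral_eq_zero := h.integral_eq_zero

lemma of_exponent_le (h : IsAtomOfHeight ν q E κ a) (hE : IsAveragingSet ν E) (hpq : p ≤ q) :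
    IsAtomOfHeight ν p E κ a where
  __ := h
  eLpNorm_cond_le :=
    have := hE.isProbabilityMeasure_cond
    (eLpNorm_le_eLpNorm_of_exponent_le hpq (h.aestronglyMeasurable.mono_ac
      ProbabilityTheory.cond_absolutelyContinuous)).trans h.eLpNorm_cond_le

lemma zero : IsAtomOfHeight ν q E κ (0 : X → F) where
  aestronglyMeasurable := aestronglyMeasurable_zero
  ae_eq_zero_of_notMem := by simp
  eLpNorm_cond_le := by simp
  integral_eq_zero := by simp

lemma const_smul {𝕜 : Type*} [RCLike 𝕜] [NormedSpace 𝕜 F] [SMulCommClass ℝ 𝕜 F]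
    (h : IsAtomOfHeight ν q E κ a) (z : 𝕜) : IsAtomOfHeight ν q E (‖z‖₊ * κ) (z • a) where
  aestronglyMeasurable := h.aestronglyMeasurable.const_smul z
  ae_eq_zero_of_notMem := by
    filter_upwards [h.ae_eq_zero_of_notMem] with x hx hxE
    simp [hx hxE]
  eLpNorm_cond_le := by
    rw [eLpNorm_const_smul, ENNReal.coe_mul]
    gcongr
    · exact le_rfl
    · exact h.eLpNorm_cond_le
  integral_eq_zero := by simp [integral_smul, h.integral_eq_zero]

lemma eLpNorm_one_le (h : IsAtomOfHeight ν q E κ a) (hE : IsAveragingSet ν E) (hq : 1 ≤ q) :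
    eLpNorm a 1 ν ≤ κ * ν E := by
  have := (h.of_exponent_le hE hq).eLpNorm_cond_le
  rw [eLpNorm_cond hE,
    eLpNorm_restrict_of_ae_eq_zero hE.measurableSet h.ae_eq_zero_of_notMem] at this
  simpa [mul_comm _ (ν E), ENNReal.inv_mul_le_iff hE.measure_ne_zero hE.measure_ne_top] using this

lemma memLp_one (h : IsAtomOfHeight ν q E κ a) (hE : IsAveragingSet ν E) (hq : 1 ≤ q) :
    MemLp a 1 ν :=
  ⟨h.aestronglyMeasurable, (h.eLpNorm_one_le hE hq).trans_lt
    (ENNReal.mul_lt_top ENNReal.coe_lt_top hE.measure_ne_top.lt_top)⟩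

end IsAtomOfHeight

variable {𝓑 : Set (Set X)} {u : Lp F 1 ν}

variable (F) in
/-- The classes in `L¹` of the `q`-atoms which live on the sets of a family `𝓑`. -/
def atoms (ν : Measure X) (q : ℝ≥0∞) (𝓑 : Set (Set X)) : Set (Lp F 1 ν) :=
  {u | ∃ E ∈ 𝓑, IsAtomOfHeight ν q E (ν E)⁻¹.toNNReal u}

lemma IsAtomOfHeight.norm_le (h : IsAtomOfHeight ν q E κ u) (hE : IsAveragingSet ν E)
    (hq : 1 ≤ q) : ‖u‖ ≤ κ * ν.real E := by
  simpa [Lp.norm_def, measureReal_def] using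
    ENNReal.toReal_mono (by finiteness [hE.measure_ne_top]) (h.eLpNorm_one_le hE hq)

lemma norm_le_one_of_mem_atoms (h𝓑 : ∀ E ∈ 𝓑, IsAveragingSet ν E) (hq : 1 ≤ q)
    (hu : u ∈ atoms F ν q 𝓑) : ‖u‖ ≤ 1 := by
  obtain ⟨E, hE, hu⟩ := hu
  refine (hu.norm_le (h𝓑 E hE) hq).trans_eq ?_
  rw [ENNReal.coe_toNNReal_eq_toReal, ENNReal.toReal_inv]
  exact inv_mul_cancel₀ (h𝓑 E hE).measureReal_ne_zero

lemma atoms_subset_of_exponent_le (h𝓑 : ∀ E ∈ 𝓑, IsAveragingSet ν E) (hpq : p ≤ q) :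
    atoms F ν q 𝓑 ⊆ atoms F ν p 𝓑 := fun _ ⟨E, hE, hu⟩ =>
  ⟨E, hE, hu.of_exponent_le (h𝓑 E hE) hpq⟩

lemma IsAtomOfHeight.isAtomicSum {𝕜 : Type*} [RCLike 𝕜] [NormedSpace 𝕜 F] [SMulCommClass ℝ 𝕜 F]
    (h : IsAtomOfHeight ν q E κ u) (hE : IsAveragingSet ν E) (hq : 1 ≤ q) (h𝓑 : E ∈ 𝓑) :
    IsAtomicSum 𝕜 (atoms F ν q 𝓑) (κ * ν.real E) u := by
  obtain rfl | hκ := eq_or_ne κ 0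
  · obtain rfl : u = 0 := by simpa using h.norm_le hE hq
    simpa using isAtomicSum_zero
  have hz : κ * ν.real E ≠ 0 := mul_ne_zero (by simpa) hE.measureReal_ne_zero
  let z : 𝕜 := ((κ * ν.real E : ℝ) : 𝕜)
  have hzu : z⁻¹ • u ∈ atoms F ν q 𝓑 := by
    refine ⟨E, h𝓑, ?_⟩
    convert (h.const_smul z⁻¹).congr (Lp.coeFn_smul _ _).symm using 1
    ext
    simp [z, measureReal_def, abs_of_nonneg, hκ, ENNReal.coe_toNNReal_eq_toReal]
  have := isAtomicSum_smul_mem hzu z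
  rw [smul_inv_smul₀ (by simpa [z] using hz)] at this
  simpa [z, abs_of_nonneg] using this

lemma enorm_setAverage_le (hE : IsAveragingSet ν E) (hq : 1 ≤ q)
    (hf : AEStronglyMeasurable f ν[|E]) : ‖⨍ x in E, f x ∂ν‖ₑ ≤ eLpNorm f q ν[|E] := by
  have := hE.isProbabilityMeasure_cond
  calc ‖⨍ x in E, f x ∂ν‖ₑ = ‖∫ x, f x ∂ν[|E]‖ₑ := by rw [setAverage_eq']; rfl
    _ ≤ eLpNorm f 1 ν[|E] := by
      rw [eLpNorm_one_eq_lintegral_enorm]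
      exact enorm_integral_le_lintegral_enorm f
    _ ≤ eLpNorm f q ν[|E] := eLpNorm_le_eLpNorm_of_exponent_le hq hf

lemma isAtomOfHeight_indicator_sub_average [CompleteSpace F] (hE : IsAveragingSet ν E)
    (hq : 1 ≤ q) (hf : AEStronglyMeasurable f ν) (hκ : eLpNorm f q ν[|E] ≤ κ) :
    IsAtomOfHeight ν q E (2 * κ) (E.indicator fun x => f x - ⨍ y in E, f y ∂ν) := by
  have := hE.isProbabilityMeasure_cond
  have hfE : AEStronglyMeasurable f ν[|E] :=
    hf.mono_ac ProbabilityTheory.cond_absolutelyContinuous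
  refine ⟨(hf.sub aestronglyMeasurable_const).indicator hE.measurableSet,
    by simp +contextual, ?_, ?_⟩
  · calc eLpNorm (E.indicator fun x => f x - ⨍ y in E, f y ∂ν) q ν[|E]
        = eLpNorm (fun x => f x - ⨍ y in E, f y ∂ν) q ν[|E] := by
          refine eLpNorm_congr_ae ?_
          filter_upwards [ProbabilityTheory.ae_cond_mem hE.measurableSet] with x hx
          simp [hx]
      _ ≤ eLpNorm f q ν[|E] + eLpNorm (fun _ => ⨍ y in E, f y ∂ν) q ν[|E] :=
          eLpNorm_sub_le hfE aestronglyMeasurable_const hq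
      _ ≤ κ + κ := by
          gcongr
          rw [eLpNorm_const _ (by positivity) (NeZero.ne _)]
          simpa using (enorm_setAverage_le hE hq hfE).trans hκ
      _ = ((2 * κ : ℝ≥0) : ℝ≥0∞) := by push_cast; ring
  · rw [integral_indicator hE.measurableSet, setAverage_sub_setAverage hE.measure_ne_top]

lemma isAtomOfHeight_inv_measure_iff (hE : IsAveragingSet ν E) :
    IsAtomOfHeight ν q E (ν E)⁻¹.toNNReal a ↔ MemLp a q ν ∧ (∀ᵐ x ∂ν, x ∉ E → a x = 0) ∧
      eLpNorm a q ν ≤ ν E ^ (q⁻¹.toReal - 1) ∧ ∫ x, a x ∂ν = 0 := by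
  have hheight (ha : ∀ᵐ x ∂ν, x ∉ E → a x = 0) : eLpNorm a q ν[|E] ≤ (ν E)⁻¹.toNNReal ↔
      eLpNorm a q ν ≤ ν E ^ (q⁻¹.toReal - 1) := by
    rw [eLpNorm_cond hE, eLpNorm_restrict_of_ae_eq_zero hE.measurableSet ha,
      ENNReal.coe_toNNReal (ENNReal.inv_ne_top.2 hE.measure_ne_zero), ENNReal.inv_rpow,
      ENNReal.rpow_sub _ _ hE.measure_ne_zero hE.measure_ne_top, ENNReal.rpow_one,
      ENNReal.inv_mul_le_iff
        (by simp [ENNReal.rpow_eq_zero_iff, hE.measure_ne_zero, hE.measure_ne_top])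
        (ENNReal.rpow_ne_top_of_nonneg ENNReal.toReal_nonneg hE.measure_ne_top), div_eq_mul_inv]
  constructor
  · rintro ⟨hmeas, hzero, hnorm, hmean⟩
    have hle := (hheight hzero).1 hnorm
    exact ⟨⟨hmeas, hle.trans_lt (ENNReal.rpow_ne_top_of_ne_zero hE.measure_ne_zero
      hE.measure_ne_top).lt_top⟩, hzero, hle, hmean⟩
  · rintro ⟨hmem, hzero, hle, hmean⟩
    exact ⟨hmem.1, hzero, (hheight hzero).2 hle, hmean⟩

end Atom

section Grid
open scoped Function ProbabilityTheory NNReal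

variable {X L : Type*} {R : Set X} {π : ℕ → X → L} {n : ℕ} {x y : X}

/-- The cell of generation `n` around `x` of the partitions of `R` described by labels: two points
lie in the same cell of generation `n` when `π n` gives them the same label. -/
def cell (R : Set X) (π : ℕ → X → L) (n : ℕ) (x : X) : Set X :=
  R ∩ π n ⁻¹' {π n x}

lemma cell_congr (h : π n x = π n y) : cell R π n x = cell R π n y := by
  simp only [cell, h]

variable [MeasurableSpace X] {ν : Measure X} {D : ℝ≥0} {h : X → ℝ≥0∞} {τ : ℝ≥0∞} {i j : ℕ × L}

/-- The labels `π` describe nested measurable partitions of `R`, starting with `R` itself, whose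
cells lose at most a factor `D` of measure from one generation to the next and satisfy Lebesgue's
differentiation theorem. -/
structure IsRegularGrid (ν : Measure X) (R : Set X) (D : ℝ≥0) (π : ℕ → X → L) : Prop where
  isAveragingSet : IsAveragingSet ν R
  measurableSet_fiber : ∀ n l, MeasurableSet (π n ⁻¹' {l})
  label_zero_eq : ∀ x ∈ R, ∀ y ∈ R, π 0 x = π 0 y
  label_eq_of_succ : ∀ n x y, π (n + 1) x = π (n + 1) y → π n x = π n y
  measure_cell_le : ∀ n, ∀ x ∈ R, ν (cell R π n x) ≤ D * ν (cell R π (n + 1) x)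
  ae_tendsto_setLAverage : ∀ h : X → ℝ≥0∞, Measurable h → ∫⁻ y in R, h y ∂ν ≠ ∞ →
    ∀ᵐ x ∂ν, x ∈ R → Tendsto (fun n => ⨍⁻ y in cell R π n x, h y ∂ν) atTop (𝓝 (h x))

/-- The set of points of label `i.2` in generation `i.1` whose cells of that generation are the
first ones on which the average of `h` exceeds `τ`. If nonempty, it is one of the maximal cells on
which the average of `h` exceeds `τ`. -/
def stoppingCell (ν : Measure X) (R : Set X) (π : ℕ → X → L) (h : X → ℝ≥0∞) (τ : ℝ≥0∞)
    (i : ℕ × L) : Set X :=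
  {x ∈ R | π i.1 x = i.2 ∧ τ < ⨍⁻ y in cell R π i.1 x, h y ∂ν ∧
    ∀ m < i.1, ⨍⁻ y in cell R π m x, h y ∂ν ≤ τ}

lemma pairwise_disjoint_stoppingCell : Pairwise (Disjoint on stoppingCell ν R π h τ) := by
  intro i j hij
  refine Set.disjoint_left.2 fun x ⟨_, hi, hi_gt, hi_le⟩ ⟨_, hj, hj_gt, hj_le⟩ => hij ?_
  have hgen : i.1 = j.1 := le_antisymm
    (not_lt.1 fun hlt => (hi_le _ hlt).not_gt hj_gt)
    (not_lt.1 fun hlt => (hj_le _ hlt).not_gt hi_gt)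
  exact Prod.ext hgen (by rw [← hi, ← hj, hgen])

namespace IsRegularGrid

variable (hπ : IsRegularGrid ν R D π)
include hπ

lemma label_eq_of_le {m n : ℕ} (hmn : m ≤ n) (h : π n x = π n y) : π m x = π m y := by
  induction n, hmn using Nat.le_induction with
  | base => exact h
  | succ n _ ih => exact ih (hπ.label_eq_of_succ n x y h)

lemma cell_zero (hx : x ∈ R) : cell R π 0 x = R :=
  inter_eq_left.2 fun y hy => hπ.label_zero_eq y hy x hx

lemma cell_succ_subset : cell R π (n + 1) x ⊆ cell R π n x :=
  fun y hy => ⟨hy.1, hπ.label_eq_of_succ n y x hy.2⟩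

lemma isAveragingSet_cell (hx : x ∈ R) (n : ℕ) : IsAveragingSet ν (cell R π n x) where
  measurableSet := hπ.isAveragingSet.measurableSet.inter (hπ.measurableSet_fiber n _)
  measure_ne_zero := by
    induction n with
    | zero =>
      rw [hπ.cell_zero hx]
      exact hπ.isAveragingSet.measure_ne_zero
    | succ n ih => exact fun h0 => ih (by simpa [h0] using hπ.measure_cell_le n x hx)
  measure_ne_top := measure_ne_top_of_subset inter_subset_left hπ.isAveragingSet.measure_ne_top

lemma setLAverage_cell_le (hx : x ∈ R) :
    ⨍⁻ y in cell R π (n + 1) x, h y ∂ν ≤ D * ⨍⁻ y in cell R π n x, h y ∂ν := by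
  have hcell := hπ.isAveragingSet_cell hx n
  have hcell' := hπ.isAveragingSet_cell hx (n + 1)
  rw [setLAverage_eq, setLAverage_eq,
    ENNReal.div_le_iff hcell'.measure_ne_zero hcell'.measure_ne_top]
  calc ∫⁻ y in cell R π (n + 1) x, h y ∂ν
      ≤ ∫⁻ y in cell R π n x, h y ∂ν := lintegral_mono_set hπ.cell_succ_subset
    _ = (∫⁻ y in cell R π n x, h y ∂ν) / ν (cell R π n x) * ν (cell R π n x) :=
        (ENNReal.div_mul_cancel hcell.measure_ne_zero hcell.measure_ne_top).symm
    _ ≤ (∫⁻ y in cell R π n x, h y ∂ν) / ν (cell R π n x) * (D * ν (cell R π (n + 1) x)) := by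
        gcongr
        exact hπ.measure_cell_le n x hx
    _ = _ := by ring

lemma one_le_doublingConst : 1 ≤ D := by
  obtain ⟨x, hx⟩ := nonempty_of_measure_ne_zero hπ.isAveragingSet.measure_ne_zero
  by_contra! hD
  have hcell := hπ.isAveragingSet_cell hx 0
  refine (hπ.measure_cell_le 0 x hx).not_gt ?_
  calc D * ν (cell R π 1 x) ≤ D * ν (cell R π 0 x) := by gcongr; exact hπ.cell_succ_subset
    _ < 1 * ν (cell R π 0 x) := by
      gcongr
      · exact hcell.measure_ne_zero
      · exact hcell.measure_ne_top
      · exact_mod_cast hD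
    _ = _ := one_mul _

lemma stoppingCell_eq_cell (hx : x ∈ stoppingCell ν R π h τ i) :
    stoppingCell ν R π h τ i = cell R π i.1 x := by
  obtain ⟨-, hlabel, hgt, hle⟩ := hx
  ext y
  refine ⟨fun hy => ⟨hy.1, hy.2.1.trans hlabel.symm⟩, fun ⟨hyR, hyx⟩ => ?_⟩
  rw [mem_preimage, mem_singleton_iff] at hyx
  refine ⟨hyR, hyx.trans hlabel, by rwa [cell_congr hyx], fun m hm => ?_⟩
  rw [cell_congr (hπ.label_eq_of_le hm.le hyx)]
  exact hle m hm

lemma lt_setLAverage_stoppingCell (hx : (stoppingCell ν R π h τ i).Nonempty) :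
    τ < ⨍⁻ y in stoppingCell ν R π h τ i, h y ∂ν := by
  obtain ⟨x, hx⟩ := hx
  rw [hπ.stoppingCell_eq_cell hx]
  exact hx.2.2.1

lemma setLAverage_stoppingCell_le (hR : ⨍⁻ y in R, h y ∂ν ≤ τ)
    (hx : (stoppingCell ν R π h τ i).Nonempty) :
    ⨍⁻ y in stoppingCell ν R π h τ i, h y ∂ν ≤ D * τ := by
  obtain ⟨x, hx⟩ := hx
  rw [hπ.stoppingCell_eq_cell hx]
  obtain ⟨hxR, -, hgt, hle⟩ := hx
  cases hi : i.1 with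
  | zero =>
    rw [hi, hπ.cell_zero hxR] at hgt
    exact absurd hgt hR.not_gt
  | succ m =>
    refine (hπ.setLAverage_cell_le hxR).trans ?_
    gcongr
    exact hle m (by omega)

lemma isAveragingSet_stoppingCell (hx : (stoppingCell ν R π h τ i).Nonempty) :
    IsAveragingSet ν (stoppingCell ν R π h τ i) := by
  obtain ⟨x, hx⟩ := hx
  exact hπ.stoppingCell_eq_cell hx ▸ hπ.isAveragingSet_cell hx.1 _

lemma mul_tsum_measure_stoppingCell_le [Countable L] :
    τ * ∑' i : {i // (stoppingCell ν R π h τ i).Nonempty}, ν (stoppingCell ν R π h τ i) ≤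
      ∫⁻ y in R, h y ∂ν := by
  rw [← ENNReal.tsum_mul_left]
  calc ∑' i : {i // (stoppingCell ν R π h τ i).Nonempty}, τ * ν (stoppingCell ν R π h τ i)
      ≤ ∑' i : {i // (stoppingCell ν R π h τ i).Nonempty},
          ∫⁻ y in stoppingCell ν R π h τ i, h y ∂ν := by
        refine ENNReal.tsum_le_tsum fun i => ENNReal.mul_le_of_le_div ?_
        rw [← setLAverage_eq]
        exact (hπ.lt_setLAverage_stoppingCell i.2).le
    _ = ∫⁻ y in ⋃ i : {i // (stoppingCell ν R π h τ i).Nonempty}, stoppingCell ν R π h τ i,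
          h y ∂ν :=
        (lintegral_iUnion (fun i => (hπ.isAveragingSet_stoppingCell i.2).measurableSet)
          (pairwise_disjoint_stoppingCell.comp_of_injective Subtype.val_injective) h).symm
    _ ≤ ∫⁻ y in R, h y ∂ν := lintegral_mono_set (iUnion_subset fun i x hx => hx.1)

lemma ae_le_of_notMem_stoppingCell (hh : Measurable h) (hR : ∫⁻ y in R, h y ∂ν ≠ ∞) :
    ∀ᵐ x ∂ν, x ∈ R → (∀ i, x ∉ stoppingCell ν R π h τ i) → h x ≤ τ := by
  filter_upwards [hπ.ae_tendsto_setLAverage h hh hR] with x hx hxR hx_cells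
  refine le_of_tendsto' (hx hxR) fun n => ?_
  induction n using Nat.strong_induction_on with
  | _ n ih => exact not_lt.1 fun hgt => hx_cells (n, π n x) ⟨hxR, rfl, hgt, ih⟩

end IsRegularGrid

end Grid

section CalderonZygmund
open scoped Function ProbabilityTheory NNReal

variable {X L ι F : Type*} [NormedAddCommGroup F]

lemma tsum_indicator_apply_of_pairwise_disjoint {E : ι → Set X}
    (hE : Pairwise (Disjoint on E)) (f : ι → X → F) {i : ι} {x : X} (hx : x ∈ E i) :
    ∑' j, (E j).indicator (f j) x = f i x := by
  rw [tsum_eq_single i fun j hj => indicator_of_notMem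
    (fun hxj => Set.disjoint_left.1 (hE hj) hxj hx) _, indicator_of_mem hx]

variable [MeasurableSpace X] {ν : Measure X} {q : ℝ≥0∞}

lemma eLpNorm_cond_eq_setLAverage (hq : q ≠ 0) (hq' : q ≠ ∞) (f : X → F) (E : Set X) :
    eLpNorm f q ν[|E] = (⨍⁻ x in E, ‖f x‖ₑ ^ q.toReal ∂ν) ^ q.toReal⁻¹ := by
  rw [eLpNorm_eq_lintegral_rpow_enorm_toReal hq hq', setLAverage_eq', one_div]
  rfl

lemma setLAverage_le_iff_eLpNorm_cond_le (hq : q ≠ 0) (hq' : q ≠ ∞) {f : X → F} {E : Set X}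
    {t : ℝ≥0∞} :
    ⨍⁻ x in E, ‖f x‖ₑ ^ q.toReal ∂ν ≤ t ^ q.toReal ↔ eLpNorm f q ν[|E] ≤ t := by
  rw [eLpNorm_cond_eq_setLAverage hq hq', ENNReal.rpow_inv_le_iff (ENNReal.toReal_pos hq hq')]

lemma setLIntegral_rpow_enorm_le (hq : q ≠ 0) (hq' : q ≠ ∞) {f : X → F} {E : Set X}
    (hE : ν E ≠ ∞) {t : ℝ≥0∞} (hf : eLpNorm f q ν[|E] ≤ t) :
    ∫⁻ x in E, ‖f x‖ₑ ^ q.toReal ∂ν ≤ t ^ q.toReal * ν E := by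
  rw [← measure_mul_setLAverage _ hE, mul_comm]
  gcongr
  exact (setLAverage_le_iff_eLpNorm_cond_le hq hq').2 hf

/-- The stopping cells of `‖f‖ ^ q` at height `l ^ q`: they are the maximal cells on which the
normalised `L^q` norm of `f` exceeds `l`. -/
abbrev lpStoppingCell (ν : Measure X) (R : Set X) (π : ℕ → X → L) (q : ℝ≥0∞) (f : X → F) (l : ℝ≥0) :
    ℕ × L → Set X :=
  stoppingCell ν R π (fun x => ‖f x‖ₑ ^ q.toReal) ((l : ℝ≥0∞) ^ q.toReal)

namespace IsRegularGrid

variable {R : Set X} {π : ℕ → X → L} {D A l : ℝ≥0} {f : X → F} (hπ : IsRegularGrid ν R D π)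
include hπ

lemma eLpNorm_cond_lpStoppingCell_le (hq : q ≠ 0) (hq' : q ≠ ∞) (hf : eLpNorm f q ν[|R] ≤ l)
    {i : ℕ × L} (hi : (lpStoppingCell ν R π q f l i).Nonempty) :
    eLpNorm f q ν[|lpStoppingCell ν R π q f l i] ≤ (D ^ q.toReal⁻¹ * l : ℝ≥0) := by
  have hr := ENNReal.toReal_pos hq hq'
  rw [← setLAverage_le_iff_eLpNorm_cond_le hq hq'] at hf ⊢
  refine (hπ.setLAverage_stoppingCell_le hf hi).trans_eq ?_
  rw [← ENNReal.coe_rpow_of_nonneg _ hr.le, ← ENNReal.coe_rpow_of_nonneg _ hr.le, NNReal.mul_rpow,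
    NNReal.rpow_inv_rpow hr.ne', ENNReal.coe_mul]

lemma tsum_measure_lpStoppingCell_le [Countable L] (hq : q ≠ 0) (hq' : q ≠ ∞)
    (hf : eLpNorm f q ν[|R] ≤ A) (hl : l ≠ 0) :
    ∑' i : {i // (lpStoppingCell ν R π q f l i).Nonempty}, ν (lpStoppingCell ν R π q f l i) ≤
      ((A / l) ^ q.toReal : ℝ≥0) * ν R := by
  have hr := ENNReal.toReal_pos hq hq'
  have hlr : (l : ℝ≥0∞) ^ q.toReal ≠ 0 := by simp [hl]
  have hlr' : (l : ℝ≥0∞) ^ q.toReal ≠ ∞ := by simp [hr.le]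
  calc _ ≤ (A : ℝ≥0∞) ^ q.toReal * ν R / (l : ℝ≥0∞) ^ q.toReal := by
        rw [ENNReal.le_div_iff_mul_le (.inl hlr) (.inl hlr'), mul_comm]
        exact hπ.mul_tsum_measure_stoppingCell_le.trans
          (setLIntegral_rpow_enorm_le hq hq' hπ.isAveragingSet.measure_ne_top hf)
    _ = _ := by
        rw [ENNReal.coe_rpow_of_nonneg _ hr.le, ENNReal.coe_div hl,
          ENNReal.div_rpow_of_nonneg _ _ hr.le, ENNReal.mul_div_right_comm]

lemma ae_enorm_sub_tsum_indicator_le [NormedSpace ℝ F] (hq : 1 ≤ q) (hq' : q ≠ ∞)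
    (hfm : StronglyMeasurable f) (hf : eLpNorm f q ν[|R] ≤ l) :
    ∀ᵐ x ∂ν, x ∈ R → ‖f x - ∑' i : {i // (lpStoppingCell ν R π q f l i).Nonempty},
      (lpStoppingCell ν R π q f l i).indicator
        (fun y => f y - ⨍ z in lpStoppingCell ν R π q f l i, f z ∂ν) x‖ₑ ≤
      (D ^ q.toReal⁻¹ * l : ℝ≥0) := by
  have hq0 : q ≠ 0 := (zero_lt_one.trans_le hq).ne'
  have hr := ENNReal.toReal_pos hq0 hq'
  have hR := hπ.isAveragingSet.measure_ne_top
  have hfin : ∫⁻ x in R, ‖f x‖ₑ ^ q.toReal ∂ν ≠ ∞ :=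
    ne_top_of_le_ne_top (by finiteness) (setLIntegral_rpow_enorm_le hq0 hq' hR hf)
  filter_upwards [hπ.ae_le_of_notMem_stoppingCell (τ := (l : ℝ≥0∞) ^ q.toReal)
    (hfm.enorm.pow_const _) hfin] with x hx hxR
  by_cases! hx_cells : ∃ i, x ∈ lpStoppingCell ν R π q f l i
  · obtain ⟨i, hi⟩ := hx_cells
    rw [tsum_indicator_apply_of_pairwise_disjoint (i := ⟨i, x, hi⟩)
      (pairwise_disjoint_stoppingCell.comp_of_injective Subtype.val_injective) _ hi, sub_sub_cancel]
    exact (enorm_setAverage_le (hπ.isAveragingSet_stoppingCell ⟨x, hi⟩) hq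
      hfm.aestronglyMeasurable).trans (hπ.eLpNorm_cond_lpStoppingCell_le hq0 hq' hf ⟨x, hi⟩)
  · simp only [indicator_of_notMem (hx_cells _), tsum_zero, sub_zero]
    calc ‖f x‖ₑ ≤ l := (ENNReal.rpow_le_rpow_iff hr).1 (hx hxR hx_cells)
      _ ≤ (D ^ q.toReal⁻¹ * l : ℝ≥0) := by
        exact_mod_cast le_mul_of_one_le_left'
          (NNReal.one_le_rpow hπ.one_le_doublingConst (by positivity))

end IsRegularGrid

variable [NormedSpace ℝ F]

lemma integral_eq_zero_of_hasSum [CompleteSpace F] {u : ι → Lp F 1 ν} {b : Lp F 1 ν}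
    (hub : HasSum u b) (hu : ∀ i, ∫ x, u i x ∂ν = 0) : ∫ x, b x ∂ν = 0 := by
  simp only [← L1.integral_eq_integral, L1.integral_eq] at hu ⊢
  have := hub.mapL (L1.integralCLM (E := F) (μ := ν))
  simp only [hu] at this
  exact this.unique hasSum_zero

variable {𝕜 : Type*} [RCLike 𝕜] [NormedSpace 𝕜 F] [SMulCommClass ℝ 𝕜 F] [CompleteSpace F]
  {𝓑 : Set (Set X)}

lemma exists_isAtomicSum_ae_eq_tsum [Countable ι] {E : ι → Set X} {a : ι → X → F}
    {κ : ℝ≥0} (hq : 1 ≤ q) (h𝓑 : ∀ B ∈ 𝓑, IsAveragingSet ν B) (hE : ∀ i, ∃ B ∈ 𝓑, E i =ᵐ[ν] B)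
    (ha : ∀ i, IsAtomOfHeight ν q (E i) κ (a i)) (hsum : ∑' i, ν (E i) ≠ ∞) :
    ∃ b : Lp F 1 ν, (b =ᵐ[ν] fun x => ∑' i, a i x) ∧ ∫ x, b x ∂ν = 0 ∧
      IsAtomicSum 𝕜 (atoms F ν q 𝓑) (κ * (∑' i, ν (E i)).toReal) b := by
  choose B hB hEB using hE
  simp only [measure_congr (hEB _)] at hsum ⊢
  have haB (i) : IsAtomOfHeight ν q (B i) κ (a i) := (ha i).congr_set (hEB i)
  have hmem (i) : MemLp (a i) 1 ν := (haB i).memLp_one (h𝓑 _ (hB i)) hq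
  let u (i : ι) : Lp F 1 ν := (hmem i).toLp
  have hu (i) : IsAtomOfHeight ν q (B i) κ (u i) := (haB i).congr (hmem i).coeFn_toLp.symm
  have hu_norm (i) : ‖u i‖ ≤ κ * ν.real (B i) := (hu i).norm_le (h𝓑 _ (hB i)) hq
  have hsum_real : Summable fun i => κ * ν.real (B i) :=
    (ENNReal.summable_toReal hsum).mul_left _
  have hu_sum : Summable u := hsum_real.of_norm_bounded hu_norm
  refine ⟨∑' i, u i, ?_, ?_, ?_⟩
  · have henorm : ∑' i, ‖u i‖ₑ ≠ ∞ := by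
      simpa [enorm_eq_nnnorm, ENNReal.tsum_coe_ne_top_iff_summable, ← NNReal.summable_coe]
        using hsum_real.of_nonneg_of_le (fun _ => norm_nonneg _) hu_norm
    filter_upwards [Lp.coeFn_tsum henorm, ae_all_iff.2 fun i => (hmem i).coeFn_toLp] with x hx hxa
    simp only [hx, u, hxa]
  · exact integral_eq_zero_of_hasSum hu_sum.hasSum fun i => (hu i).integral_eq_zero
  · have := IsAtomicSum.of_hasSum (𝕜 := 𝕜) (fun u hu => norm_le_one_of_mem_atoms h𝓑 hq hu)
      (fun i => (hu i).isAtomicSum (𝕜 := 𝕜) (h𝓑 _ (hB i)) hq (hB i)) hsum_real hu_sum.hasSum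
    rw [ENNReal.tsum_toReal_eq fun i => (h𝓑 _ (hB i)).measure_ne_top]
    simpa only [tsum_mul_left, measureReal_def] using this

/-- The good part is the mean of `f` on each stopping cell and `f` itself elsewhere; the bad part is
the sum of the oscillations of `f` on the stopping cells. -/
theorem IsRegularGrid.exists_calderonZygmund [Countable L] {R : Set X} {π : ℕ → X → L} {D A l : ℝ≥0}
    (hπ : IsRegularGrid ν R D π) (hq : 1 ≤ q) (hq' : q ≠ ∞) (h𝓑 : ∀ B ∈ 𝓑, IsAveragingSet ν B)
    (hcell : ∀ n, ∀ x ∈ R, ∃ B ∈ 𝓑, cell R π n x =ᵐ[ν] B) (hl : l ≠ 0) (hAl : A ≤ l) {f : Lp F 1 ν}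
    (hf : IsAtomOfHeight ν q R A f) :
    ∃ g : Lp F 1 ν, IsAtomOfHeight ν ∞ R (D ^ q.toReal⁻¹ * l) g ∧
      IsAtomicSum 𝕜 (atoms F ν q 𝓑)
        ((2 * (D ^ q.toReal⁻¹ * l) * (A / l) ^ q.toReal : ℝ≥0) * ν.real R) (f - g) := by
  have hq0 : q ≠ 0 := (zero_lt_one.trans_le hq).ne'
  have hfl : eLpNorm f q ν[|R] ≤ l := hf.eLpNorm_cond_le.trans (by exact_mod_cast hAl)
  have hmass := hπ.tsum_measure_lpStoppingCell_le hq0 hq' hf.eLpNorm_cond_le hl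
  have hmass_top : ((A / l) ^ q.toReal : ℝ≥0) * ν R ≠ ∞ :=
    ENNReal.mul_ne_top ENNReal.coe_ne_top hπ.isAveragingSet.measure_ne_top
  obtain ⟨b, hb, hb_int, hb_sum⟩ := exists_isAtomicSum_ae_eq_tsum (𝕜 := 𝕜) hq h𝓑
    (E := fun i : {i // (lpStoppingCell ν R π q f l i).Nonempty} => lpStoppingCell ν R π q f l i)
    (fun ⟨i, x, hx⟩ => by
      simpa only [lpStoppingCell, hπ.stoppingCell_eq_cell hx] using hcell _ x hx.1)
    (fun i => isAtomOfHeight_indicator_sub_average (hπ.isAveragingSet_stoppingCell i.2) hq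
      (Lp.aestronglyMeasurable f) (hπ.eLpNorm_cond_lpStoppingCell_le hq0 hq' hfl i.2))
    (ne_top_of_le_ne_top hmass_top hmass)
  have hgood := hπ.ae_enorm_sub_tsum_indicator_le hq hq' (Lp.stronglyMeasurable f) hfl
  refine ⟨f - b, ⟨Lp.aestronglyMeasurable _, ?_, ?_, ?_⟩, ?_⟩
  · filter_upwards [Lp.coeFn_sub f b, hf.ae_eq_zero_of_notMem, hb] with x hx hfx hbx hxR
    have hx_cells (i) : x ∉ lpStoppingCell ν R π q f l i := fun hi => hxR hi.1
    rw [hx, Pi.sub_apply, hfx hxR, hbx]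
    simp [indicator_of_notMem (hx_cells _)]
  · refine eLpNormEssSup_le_of_ae_enorm_bound ?_
    filter_upwards [ProbabilityTheory.ae_cond_mem hπ.isAveragingSet.measurableSet,
      ProbabilityTheory.cond_absolutelyContinuous.ae_le (Lp.coeFn_sub f b),
      ProbabilityTheory.cond_absolutelyContinuous.ae_le hb,
      ProbabilityTheory.cond_absolutelyContinuous.ae_le hgood] with x hxR hx hbx hgx
    simpa only [hx, Pi.sub_apply, hbx] using hgx hxR
  · rw [integral_congr_ae (Lp.coeFn_sub f b), integral_sub' (L1.integrable_coeFn f)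
      (L1.integrable_coeFn b), hf.integral_eq_zero, hb_int, sub_zero]
  · rw [sub_sub_cancel]
    refine hb_sum.of_le ?_
    have := ENNReal.toReal_mono hmass_top hmass
    rw [ENNReal.toReal_mul, ENNReal.coe_toReal, ← measureReal_def] at this
    rw [NNReal.coe_mul _ ((A / l) ^ q.toReal), mul_assoc]
    gcongr

lemma exists_one_le_mul_inv_rpow_eq {M : ℝ≥0} {r : ℝ} (hM : 1 ≤ M) (hr : 1 < r) :
    ∃ κ : ℝ≥0, 1 ≤ κ ∧ 2 * (M * κ) * κ⁻¹ ^ r = 1 / 2 := by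
  have hr' : 0 < r - 1 := sub_pos.2 hr
  have h4M : 1 ≤ 4 * M := le_mul_of_one_le_of_le (by norm_num) hM
  set κ : ℝ≥0 := (4 * M) ^ (r - 1)⁻¹ with hκ
  have hκ0 : κ ≠ 0 := by positivity
  have hκr : κ ^ r = 4 * M * κ := by
    rw [← sub_add_cancel r 1, NNReal.rpow_add hκ0, hκ, NNReal.rpow_inv_rpow hr'.ne',
      NNReal.rpow_one]
  refine ⟨κ, NNReal.one_le_rpow h4M (by positivity), ?_⟩
  rw [NNReal.inv_rpow, hκr]
  field_simp
  norm_num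

/-- The constants come from cutting an atom `f` on `R` at the height `κ / ν R`: the bad part has
atomic norm at most `2 * D ^ q⁻¹ * κ ^ (1 - q)`, so at most `1 / 2` for large `κ`, and this part can
be decomposed again. -/
theorem exists_isAtomicSum_top_of_isRegularGrid [Countable L] {D : ℝ≥0} (hD : 1 ≤ D) (hq : 1 < q)
    (hq' : q ≠ ∞) (h𝓑 : ∀ B ∈ 𝓑, IsAveragingSet ν B)
    (hgrid : ∀ R ∈ 𝓑, ∃ π : ℕ → X → L, IsRegularGrid ν R D π ∧
      ∀ n, ∀ x ∈ R, ∃ B ∈ 𝓑, cell R π n x =ᵐ[ν] B) :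
    ∃ C : ℝ, 0 < C ∧ ∀ (c : ℝ) (f : Lp F 1 ν), IsAtomicSum 𝕜 (atoms F ν q 𝓑) c f →
      IsAtomicSum 𝕜 (atoms F ν ∞ 𝓑) (C * c) f := by
  set M : ℝ≥0 := D ^ q.toReal⁻¹ with hM
  have hM1 : 1 ≤ M := NNReal.one_le_rpow hD (by positivity)
  obtain ⟨κ, hκ, hκM⟩ := exists_one_le_mul_inv_rpow_eq hM1
    (by simpa using (ENNReal.toReal_lt_toReal (by simp) hq').2 hq)
  have : 0 < M := zero_lt_one.trans_le hM1
  have hκ0 : 0 < κ := zero_lt_one.trans_le hκ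
  refine ⟨2 * (M * κ), by positivity, fun c f hf => ?_⟩
  suffices h : IsAtomicSum 𝕜 (atoms F ν ∞ 𝓑) (M * κ * (c / (1 - 1 / 2))) f by
    convert h using 1; ring
  refine hf.of_approx (fun u hu => norm_le_one_of_mem_atoms h𝓑 hq.le hu)
    (fun u hu => norm_le_one_of_mem_atoms h𝓑 le_top hu) (by positivity) (by norm_num)
    (by norm_num) ?_
  rintro u ⟨R, hR, hu⟩
  obtain ⟨π, hπ, hcell⟩ := hgrid R hR
  have hRν := hπ.isAveragingSet
  set m : ℝ≥0 := (ν R)⁻¹.toNNReal with hm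
  have hmR : (m : ℝ) * ν.real R = 1 := by
    rw [hm, ENNReal.coe_toNNReal_eq_toReal, ENNReal.toReal_inv]
    exact inv_mul_cancel₀ hRν.measureReal_ne_zero
  have hm0 : m ≠ 0 := fun h => by simp [h] at hmR
  obtain ⟨g, hg, hug⟩ := hπ.exists_calderonZygmund (𝕜 := 𝕜) hq.le hq' h𝓑 hcell
    (mul_ne_zero hκ0.ne' hm0) (le_mul_of_one_le_left' hκ) hu
  refine ⟨g, (hg.isAtomicSum hRν le_top hR).of_le ?_, hug.of_le ?_⟩
  · rw [← hM]
    push_cast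
    linear_combination (M * κ : ℝ) * hmR
  · have hmκ : 2 * (M * (κ * m)) * (m / (κ * m)) ^ q.toReal = 1 / 2 * m := by
      rw [← hκM, div_mul_cancel_right₀ hm0]
      ring
    rw [hmκ]
    push_cast
    linear_combination 1 / 2 * hmR

end CalderonZygmund

section Transport
open ProbabilityTheory
open scoped NNReal

variable {X Y L : Type*} [MeasurableSpace X] [MeasurableSpace Y] {ν : Measure X} {μ : Measure Y}
  {R : Set X} {U Q : Set Y} {Φ : X → Y} {D : ℝ≥0} {π : ℕ → Y → L}

lemma map_cond_preimage (hΦ : Measurable Φ) (hQ : MeasurableSet Q) :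
    ν[|Φ ⁻¹' Q].map Φ = (ν.map Φ)[|Q] := by
  rw [ProbabilityTheory.cond, ProbabilityTheory.cond, Measure.map_smul,
    Measure.restrict_map hΦ hQ, Measure.map_apply hΦ hQ]

lemma map_cond_inter_preimage (hR : IsAveragingSet ν R) (hU : IsAveragingSet μ U)
    (hΦ : Measurable Φ) (hmap : ν[|R].map Φ = μ[|U]) (hQ : MeasurableSet Q) :
    ν[|R ∩ Φ ⁻¹' Q].map Φ = μ[|U ∩ Q] := by
  rw [← cond_cond_eq_cond_inter' hR.measurableSet (hΦ hQ) hR.measure_ne_top,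
    map_cond_preimage hΦ hQ, hmap, cond_cond_eq_cond_inter' hU.measurableSet hQ hU.measure_ne_top]

lemma measure_inter_preimage_eq_mul (hR : IsAveragingSet ν R) (hU : IsAveragingSet μ U)
    (hΦ : Measurable Φ) (hmap : ν[|R].map Φ = μ[|U]) (hQ : MeasurableSet Q) :
    ν (R ∩ Φ ⁻¹' Q) = ν R * (μ U)⁻¹ * μ (U ∩ Q) := by
  rw [mul_assoc, ← cond_apply hU.measurableSet, ← hmap, Measure.map_apply hΦ hQ,
    cond_apply hR.measurableSet, ENNReal.mul_inv_cancel_left hR.measure_ne_zero hR.measure_ne_top]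

lemma setLAverage_inter_preimage (hR : IsAveragingSet ν R) (hU : IsAveragingSet μ U)
    (hΦ : Measurable Φ) (hmap : ν[|R].map Φ = μ[|U]) (hQ : MeasurableSet Q) {g : Y → ℝ≥0∞}
    (hg : Measurable g) :
    ⨍⁻ x in R ∩ Φ ⁻¹' Q, g (Φ x) ∂ν = ⨍⁻ y in U ∩ Q, g y ∂μ := by
  rw [setLAverage_eq', setLAverage_eq', ← lintegral_map hg hΦ]
  change ∫⁻ y, g y ∂(ν[|R ∩ Φ ⁻¹' Q].map Φ) = _
  rw [map_cond_inter_preimage hR hU hΦ hmap hQ]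
  rfl

lemma exists_measurable_comp_eqOn [StandardBorelSpace X] [MeasurableSpace.CountablySeparated Y]
    (hR : MeasurableSet R) (hΦ : Measurable Φ) (hinj : InjOn Φ R) {h : X → ℝ≥0∞}
    (hh : Measurable h) : ∃ g : Y → ℝ≥0∞, Measurable g ∧ EqOn h (g ∘ Φ) R := by
  have := hR.standardBorel
  obtain ⟨g, hg, hgΦ⟩ := ((hΦ.comp measurable_subtype_coe).measurableEmbedding
    hinj.injective).exists_measurable_extend (hh.comp measurable_subtype_coe) fun _ => ⟨0⟩
  exact ⟨g, hg, fun x hx => (congrFun hgΦ ⟨x, hx⟩).symm⟩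

theorem IsRegularGrid.comap [StandardBorelSpace X] [MeasurableSpace.CountablySeparated Y]
    (hπ : IsRegularGrid μ U D π) (hR : IsAveragingSet ν R) (hΦ : Measurable Φ)
    (hΦR : MapsTo Φ R U) (hinj : InjOn Φ R) (hmap : ν[|R].map Φ = μ[|U]) :
    IsRegularGrid ν R D fun n => π n ∘ Φ where
  isAveragingSet := hR
  measurableSet_fiber n l := hΦ (hπ.measurableSet_fiber n l)
  label_zero_eq x hx y hy := hπ.label_zero_eq _ (hΦR hx) _ (hΦR hy)
  label_eq_of_succ n x y := hπ.label_eq_of_succ n _ _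
  measure_cell_le n x hx := by
    have hcell (m : ℕ) :
        ν (cell R (fun n => π n ∘ Φ) m x) = ν R * (μ U)⁻¹ * μ (cell U π m (Φ x)) :=
      measure_inter_preimage_eq_mul hR hπ.isAveragingSet hΦ hmap (hπ.measurableSet_fiber m _)
    rw [hcell, hcell, mul_left_comm]
    gcongr
    exact hπ.measure_cell_le n _ (hΦR hx)
  ae_tendsto_setLAverage h hh hfin := by
    obtain ⟨g, hg, hhg⟩ := exists_measurable_comp_eqOn hR.measurableSet hΦ hinj hh
    have havg {Q : Set Y} (hQ : MeasurableSet Q) :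
        ⨍⁻ x in R ∩ Φ ⁻¹' Q, h x ∂ν = ⨍⁻ y in U ∩ Q, g y ∂μ :=
      (setLAverage_congr_fun (hR.measurableSet.inter (hΦ hQ)) (hhg.mono inter_subset_left)).trans
        (setLAverage_inter_preimage hR hπ.isAveragingSet hΦ hmap hQ hg)
    have hgfin : ∫⁻ y in U, g y ∂μ ≠ ∞ := by
      have hU := hπ.isAveragingSet
      have h_univ := havg MeasurableSet.univ
      rw [preimage_univ, inter_univ, inter_univ, setLAverage_eq, setLAverage_eq] at h_univ
      refine fun htop => ENNReal.div_ne_top hfin hR.measure_ne_zero ?_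
      rw [h_univ, htop, ENNReal.top_div_of_ne_top hU.measure_ne_top]
    have hlim := (cond_absolutelyContinuous (s := U)).ae_le (hπ.ae_tendsto_setLAverage g hg hgfin)
    rw [← hmap] at hlim
    have hlimR := (Measure.ae_ennreal_smul_measure_iff
      (ENNReal.inv_ne_zero.2 hR.measure_ne_top)).1 (ae_of_ae_map hΦ.aemeasurable hlim)
    filter_upwards [(ae_restrict_iff' hR.measurableSet).1 hlimR] with x hx hxR
    rw [hhg hxR]
    exact (hx hxR (hΦR hxR)).congr fun n => (havg (hπ.measurableSet_fiber n _)).symm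

end Transport

section Dyadic

/-- The label, in generation `n`, of the dyadic square of side length `2⁻ⁿ` which contains `y`. -/
def dyadicLabel (n : ℕ) (y : ℝ × ℝ) : ℤ × ℤ :=
  (⌊2 ^ n * y.1⌋, ⌊2 ^ n * y.2⌋)

/-- The half-open dyadic interval of generation `n` with left endpoint `k / 2 ^ n`. -/
def dyadicIco (n : ℕ) (k : ℤ) : Set ℝ :=
  Ico ((k : ℝ) / 2 ^ n) ((k + 1) / 2 ^ n)

variable {n : ℕ} {k : ℤ} {t : ℝ}

lemma measurable_dyadicLabel (n : ℕ) : Measurable (dyadicLabel n) := by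
  unfold dyadicLabel; fun_prop

lemma floor_two_pow_mul_eq_iff : ⌊2 ^ n * t⌋ = k ↔ t ∈ dyadicIco n k := by
  have h : (0 : ℝ) < 2 ^ n := by positivity
  rw [Int.floor_eq_iff, dyadicIco, mem_Ico, div_le_iff₀ h, lt_div_iff₀ h, mul_comm t]

lemma preimage_dyadicLabel (n : ℕ) (k : ℤ × ℤ) :
    dyadicLabel n ⁻¹' {k} = dyadicIco n k.1 ×ˢ dyadicIco n k.2 := by
  ext y
  rw [mem_preimage, mem_singleton_iff, dyadicLabel, mem_prod, Prod.ext_iff,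
    floor_two_pow_mul_eq_iff, floor_two_pow_mul_eq_iff]

lemma floor_two_pow_mul_eq_floor_div_two (n : ℕ) (t : ℝ) :
    ⌊2 ^ n * t⌋ = ⌊2 ^ (n + 1) * t⌋ / 2 := by
  rw [show (2 : ℝ) ^ n * t = 2 ^ (n + 1) * t / (2 : ℕ) by push_cast; ring, Int.floor_div_natCast]
  rfl

lemma dyadicIco_subset (ht : t ∈ Ico (0 : ℝ) 1) : dyadicIco n ⌊2 ^ n * t⌋ ⊆ Ico 0 1 := by
  have h : (0 : ℝ) < 2 ^ n := by positivity
  have hfloor : ⌊2 ^ n * t⌋ < (2 : ℤ) ^ n := by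
    rw [Int.floor_lt]
    push_cast
    exact mul_lt_of_lt_one_right h ht.2
  refine Ico_subset_Ico (div_nonneg ?_ h.le) ((div_le_one h).2 (by exact_mod_cast hfloor))
  exact_mod_cast Int.floor_nonneg.2 (mul_nonneg h.le ht.1)

lemma volume_dyadicIco (n : ℕ) (k : ℤ) : volume (dyadicIco n k) = 2⁻¹ ^ n := by
  rw [dyadicIco, Real.volume_Ico, ← sub_div, add_sub_cancel_left, ← inv_eq_one_div, ← inv_pow,
    ENNReal.ofReal_pow (by positivity), ENNReal.ofReal_inv_of_pos two_pos, ENNReal.ofReal_ofNat]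

lemma closedBall_eq_dyadicIcc (n : ℕ) (k : ℤ) :
    Metric.closedBall ((k + 1 / 2) / 2 ^ n : ℝ) (1 / 2 / 2 ^ n) =
      Icc ((k : ℝ) / 2 ^ n) ((k + 1) / 2 ^ n) := by
  rw [Real.closedBall_eq_Icc]
  congr 1 <;> ring

/-- The centre of the dyadic square of generation `n` with label `k`. -/
def dyadicCenter (n : ℕ) (k : ℤ × ℤ) : ℝ × ℝ :=
  ((k.1 + 1 / 2) / 2 ^ n, (k.2 + 1 / 2) / 2 ^ n)

lemma dyadicIco_prod_ae_eq_closedBall (n : ℕ) (k : ℤ × ℤ) :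
    dyadicIco n k.1 ×ˢ dyadicIco n k.2 =ᵐ[volume]
      Metric.closedBall (dyadicCenter n k) (1 / 2 / 2 ^ n) := by
  rw [dyadicCenter, ← closedBall_prod_same, closedBall_eq_dyadicIcc, closedBall_eq_dyadicIcc,
    Measure.volume_eq_prod]
  exact Measure.set_prod_ae_eq Ico_ae_eq_Icc Ico_ae_eq_Icc

lemma mem_closedBall_dyadicCenter (n : ℕ) (y : ℝ × ℝ) :
    y ∈ Metric.closedBall (dyadicCenter n (dyadicLabel n y)) (1 / 2 / 2 ^ n) := by
  rw [dyadicCenter, ← closedBall_prod_same, closedBall_eq_dyadicIcc, closedBall_eq_dyadicIcc]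
  exact ⟨Ico_subset_Icc_self (floor_two_pow_mul_eq_iff.1 rfl),
    Ico_subset_Icc_self (floor_two_pow_mul_eq_iff.1 rfl)⟩

lemma ae_tendsto_setLAverage_dyadicLabel {h : ℝ × ℝ → ℝ≥0∞} (hh : Measurable h)
    (hfin : ∫⁻ y, h y ≠ ∞) :
    ∀ᵐ x, Tendsto (fun n => ⨍⁻ y in dyadicLabel n ⁻¹' {dyadicLabel n x}, h y ∂volume) atTop
      (𝓝 (h x)) := by
  filter_upwards [(IsUnifLocDoublingMeasure.vitaliFamily (volume : Measure (ℝ × ℝ))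
    1).ae_tendsto_lintegral_div hh.aemeasurable hfin] with x hx
  have hradius : Tendsto (fun n : ℕ => (1 / 2 / 2 ^ n : ℝ)) atTop (𝓝[>] 0) := by
    refine tendsto_nhdsWithin_iff.2 ⟨?_, Eventually.of_forall fun n => mem_Ioi.2 (by positivity)⟩
    exact tendsto_const_nhds.div_atTop (tendsto_pow_atTop_atTop_of_one_lt one_lt_two)
  have hball := IsUnifLocDoublingMeasure.tendsto_closedBall_filterAt (volume : Measure (ℝ × ℝ))
    (K := 1) (x := x) (fun n => dyadicCenter n (dyadicLabel n x)) _ hradius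
    (Eventually.of_forall fun n => by rw [one_mul]; exact mem_closedBall_dyadicCenter n x)
  refine (hx.comp hball).congr fun n => ?_
  rw [preimage_dyadicLabel,
    setLAverage_congr (dyadicIco_prod_ae_eq_closedBall n (dyadicLabel n x)), setLAverage_eq,
    Function.comp_apply]

lemma cell_dyadicLabel {x : ℝ × ℝ} (hx : x ∈ Ico (0 : ℝ) 1 ×ˢ Ico (0 : ℝ) 1) (n : ℕ) :
    cell (Ico 0 1 ×ˢ Ico 0 1) dyadicLabel n x =
      dyadicIco n (dyadicLabel n x).1 ×ˢ dyadicIco n (dyadicLabel n x).2 := by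
  rw [cell, preimage_dyadicLabel]
  exact inter_eq_right.2 (prod_mono (dyadicIco_subset hx.1) (dyadicIco_subset hx.2))

theorem isRegularGrid_dyadicLabel :
    IsRegularGrid volume (Ico (0 : ℝ) 1 ×ˢ Ico (0 : ℝ) 1) 4 dyadicLabel where
  isAveragingSet :=
    { measurableSet := measurableSet_Ico.prod measurableSet_Ico
      measure_ne_zero := by simp [Measure.volume_eq_prod]
      measure_ne_top := by simp [Measure.volume_eq_prod] }
  measurableSet_fiber n l := measurable_dyadicLabel n (measurableSet_singleton l)
  label_zero_eq x hx y hy := by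
    have hzero {t : ℝ} (ht : t ∈ Ico (0 : ℝ) 1) : ⌊2 ^ 0 * t⌋ = 0 := by
      rwa [pow_zero, one_mul, Int.floor_eq_zero_iff]
    simp only [dyadicLabel, hzero hx.1, hzero hx.2, hzero hy.1, hzero hy.2]
  label_eq_of_succ n x y h := by
    simp only [dyadicLabel, Prod.mk.injEq] at h ⊢
    simp only [floor_two_pow_mul_eq_floor_div_two n, h, and_self]
  measure_cell_le n x hx := by
    rw [cell_dyadicLabel hx, cell_dyadicLabel hx, Measure.volume_eq_prod, Measure.prod_prod,
      Measure.prod_prod]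
    simp only [volume_dyadicIco, pow_succ]
    have hfour : (4 : ℝ≥0∞) * (2⁻¹ * 2⁻¹) = 1 := by
      rw [← ENNReal.mul_inv (by simp) (by simp), show (2 : ℝ≥0∞) * 2 = 4 by norm_num,
        ENNReal.mul_inv_cancel (by simp) (by simp)]
    rw [mul_mul_mul_comm, mul_left_comm]
    simp [hfour]
  ae_tendsto_setLAverage h hh hfin := by
    set U : Set (ℝ × ℝ) := Ico 0 1 ×ˢ Ico 0 1
    have hU : MeasurableSet U := measurableSet_Ico.prod measurableSet_Ico
    rw [← lintegral_indicator hU] at hfin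
    filter_upwards [ae_tendsto_setLAverage_dyadicLabel (hh.indicator hU) hfin] with x hx hxU
    rw [indicator_of_mem hxU] at hx
    refine hx.congr fun n => ?_
    rw [← setLAverage_congr_fun (s := cell U dyadicLabel n x) (f := U.indicator h)
      (hU.inter (measurable_dyadicLabel n (measurableSet_singleton _)))
      fun y hy => indicator_of_mem hy.1 h, cell_dyadicLabel hxU, preimage_dyadicLabel]

end Dyadic

section DistributionFunction
open ProbabilityTheory

variable {μ m : Measure ℝ} {a b s t : ℝ}

lemma continuous_cdf (μ : Measure ℝ) [IsProbabilityMeasure μ] [NullSingletonClass μ] :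
    Continuous (cdf μ) := by
  refine continuous_iff_continuousAt.2 fun x => ?_
  have hmass := (cdf μ).measure_singleton x
  rw [measure_cdf, measure_singleton, eq_comm, ENNReal.ofReal_eq_zero, sub_nonpos] at hmass
  rw [(monotone_cdf μ).continuousAt_iff_leftLim_eq_rightLim, StieltjesFunction.rightLim_eq]
  exact ((monotone_cdf μ).leftLim_le le_rfl).antisymm hmass

lemma measure_preimage_cdf_Iic (μ : Measure ℝ) [IsProbabilityMeasure μ] [NullSingletonClass μ]
    (hs : s < 1) :
    μ (cdf μ ⁻¹' Iic s) = ENNReal.ofReal s := by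
  obtain ⟨y, hy⟩ := ((tendsto_cdf_atTop μ).eventually_const_lt hs).exists
  have hupper : ∀ x ∈ cdf μ ⁻¹' Iic s, x ≤ y := fun x hx =>
    ((monotone_cdf μ).reflect_lt (lt_of_le_of_lt hx hy)).le
  rcases (cdf μ ⁻¹' Iic s).eq_empty_or_nonempty with hempty | hne
  · have hs0 : s ≤ 0 := ge_of_tendsto' (tendsto_cdf_atBot μ) fun x =>
      (not_le.1 fun hx => (hempty ▸ hx : x ∈ (∅ : Set ℝ))).le
    rw [hempty, measure_empty, ENNReal.ofReal_of_nonpos hs0]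
  · set z := sSup (cdf μ ⁻¹' Iic s)
    have hz : cdf μ z ≤ s := (isClosed_Iic.preimage (continuous_cdf μ)).csSup_mem hne ⟨y, hupper⟩
    have hIic : cdf μ ⁻¹' Iic s = Iic z := Subset.antisymm
      (fun x hx => le_csSup ⟨y, hupper⟩ hx) fun x hx => (monotone_cdf μ hx).trans hz
    obtain ⟨x, -, hx⟩ := intermediate_value_Icc (hupper z hz) (continuous_cdf μ).continuousOn
      ⟨hz, hy.le⟩
    have hxz : x ∈ Iic z := hIic ▸ hx.le
    rw [hIic, ← ofReal_cdf, hz.antisymm (hx ▸ monotone_cdf μ hxz)]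

theorem map_cdf (μ : Measure ℝ) [IsProbabilityMeasure μ] [NullSingletonClass μ] :
    μ.map (cdf μ) = volume.restrict (Ico 0 1) := by
  have hmeas : Measurable (cdf μ) := (monotone_cdf μ).measurable
  refine Measure.ext_of_Iic _ _ fun s => ?_
  rw [Measure.map_apply hmeas measurableSet_Iic, Measure.restrict_apply measurableSet_Iic]
  rcases lt_or_ge s 1 with hs | hs
  · rw [measure_preimage_cdf_Iic μ hs, show Iic s ∩ Ico 0 1 = Icc 0 s by grind,
      Real.volume_Icc, sub_zero]
  · rw [inter_eq_right.2 fun x hx => hx.2.le.trans hs, eq_univ_of_forall fun x =>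
      mem_preimage.2 ((cdf_le_one μ x).trans hs)]
    simp

instance nullSingletonClass_cond {X : Type*} [MeasurableSpace X] (ν : Measure X)
    [NullSingletonClass ν] (E : Set X) : NullSingletonClass ν[|E] :=
  ⟨fun x => cond_absolutelyContinuous (measure_singleton x)⟩

/-- Every nondegenerate open subinterval of `(a, b)` has positive finite mass. -/
structure IsChargedInterval (m : Measure ℝ) (a b : ℝ) : Prop where
  lt : a < b
  isAveragingSet_Ioo : ∀ ⦃s t⦄, a ≤ s → s < t → t ≤ b → IsAveragingSet m (Ioo s t)

namespace IsChargedInterval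

variable (h : IsChargedInterval m a b)
include h

lemma isAveragingSet : IsAveragingSet m (Ioo a b) :=
  h.isAveragingSet_Ioo le_rfl h.lt le_rfl

lemma strictMonoOn_cdf : StrictMonoOn (cdf m[|Ioo a b]) (Icc a b) := by
  have := h.isAveragingSet.isProbabilityMeasure_cond
  intro s hs t ht hst
  by_contra! hle
  have hnull : m[|Ioo a b] (Ioo s t) = 0 := by
    refine measure_mono_null Ioo_subset_Ioc_self ?_
    rw [← measure_cdf m[|Ioo a b], StieltjesFunction.measure_Ioc,
      ENNReal.ofReal_of_nonpos (sub_nonpos.2 hle)]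
  rw [cond_apply measurableSet_Ioo, inter_eq_right.2 (Ioo_subset_Ioo hs.1 ht.2)] at hnull
  exact (mul_ne_zero (ENNReal.inv_ne_zero.2 h.isAveragingSet.measure_ne_top)
    (h.isAveragingSet_Ioo hs.1 hst ht.2).measure_ne_zero) hnull

lemma cdf_left : cdf m[|Ioo a b] a = 0 := by
  have := h.isAveragingSet.isProbabilityMeasure_cond
  have hempty : Ioo a b ∩ Iic a = ∅ := by grind
  rw [cdf_eq_real, measureReal_def, cond_apply measurableSet_Ioo, hempty]
  simp

lemma cdf_right : cdf m[|Ioo a b] b = 1 := by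
  have hprob := h.isAveragingSet.isProbabilityMeasure_cond
  refine (cdf_le_one _ b).antisymm ?_
  have hone : m[Ioo a b | Ioo a b] = 1 :=
    cond_apply_self h.isAveragingSet.measure_ne_zero h.isAveragingSet.measure_ne_top
  rw [← ENNReal.one_le_ofReal, ofReal_cdf, ← hone]
  exact measure_mono fun x hx => hx.2.le

lemma mapsTo_cdf : MapsTo (cdf m[|Ioo a b]) (Ioo a b) (Ico 0 1) := by
  intro x hx
  rw [← h.cdf_right]
  exact ⟨cdf_nonneg _ x,
    h.strictMonoOn_cdf (Ioo_subset_Icc_self hx) (right_mem_Icc.2 h.lt.le) hx.2⟩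

lemma exists_cdf_eq [NullSingletonClass m] (hs : s ∈ Icc (0 : ℝ) 1) :
    ∃ x ∈ Icc a b, cdf m[|Ioo a b] x = s := by
  have := h.isAveragingSet.isProbabilityMeasure_cond
  rw [← h.cdf_left, ← h.cdf_right] at hs
  exact intermediate_value_Icc h.lt.le (continuous_cdf _).continuousOn hs

lemma exists_inter_preimage_cdf_ae_eq [NullSingletonClass m] (hs : 0 ≤ s) (hst : s < t)
    (ht : t ≤ 1) : ∃ x y, a ≤ x ∧ x < y ∧ y ≤ b ∧
      (Ioo a b ∩ cdf m[|Ioo a b] ⁻¹' Ico s t : Set ℝ) =ᵐ[m] Ioo x y := by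
  have hmono := h.strictMonoOn_cdf
  obtain ⟨x, hx, rfl⟩ := h.exists_cdf_eq ⟨hs, hst.le.trans ht⟩
  obtain ⟨y, hy, rfl⟩ := h.exists_cdf_eq ⟨hs.trans hst.le, ht⟩
  refine ⟨x, y, hx.1, (hmono.lt_iff_lt hx hy).1 hst, hy.2, ?_⟩
  have hpre : Ioo a b ∩ cdf m[|Ioo a b] ⁻¹' Ico (cdf m[|Ioo a b] x) (cdf m[|Ioo a b] y) =
      Ioo a b ∩ Ico x y := by
    ext z
    refine and_congr_right fun hz => ?_
    have hz := Ioo_subset_Icc_self hz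
    exact and_congr (hmono.le_iff_le hx hz) (hmono.lt_iff_lt hz hy)
  rw [hpre, ← inter_eq_right.2 (Ioo_subset_Ioo hx.1 hy.2)]
  exact (ae_eq_refl _).inter Ioo_ae_eq_Ico.symm

end IsChargedInterval

end DistributionFunction

section Product
open ProbabilityTheory

lemma IsAveragingSet.prod {X Y : Type*} [MeasurableSpace X] [MeasurableSpace Y] {ν : Measure X}
    {μ : Measure Y} [SFinite μ] {E : Set X} {E' : Set Y} (hE : IsAveragingSet ν E)
    (hE' : IsAveragingSet μ E') : IsAveragingSet (ν.prod μ) (E ×ˢ E') where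
  measurableSet := hE.measurableSet.prod hE'.measurableSet
  measure_ne_zero := by
    rw [Measure.prod_prod]
    exact mul_ne_zero hE.measure_ne_zero hE'.measure_ne_zero
  measure_ne_top := by
    rw [Measure.prod_prod]
    exact ENNReal.mul_ne_top hE.measure_ne_top hE'.measure_ne_top

lemma cond_prod {X Y : Type*} [MeasurableSpace X] [MeasurableSpace Y] {ν : Measure X}
    {μ : Measure Y} [SFinite ν] [SFinite μ] {E : Set X} (hE : IsAveragingSet ν E) (E' : Set Y) :
    (ν.prod μ)[|E ×ˢ E'] = ν[|E].prod μ[|E'] := by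
  simp only [ProbabilityTheory.cond]
  rw [Measure.prod_smul_left, Measure.prod_smul_right, Measure.prod_restrict, smul_smul,
    Measure.prod_prod, ENNReal.mul_inv (.inl hE.measure_ne_zero) (.inl hE.measure_ne_top)]

variable {m m' : Measure ℝ} [NullSingletonClass m] [NullSingletonClass m'] {a b c d : ℝ}

lemma map_cond_prodMap_cdf [SFinite m] [SFinite m'] (h : IsChargedInterval m a b)
    (h' : IsChargedInterval m' c d) :
    (m.prod m')[|Ioo a b ×ˢ Ioo c d].map (Prod.map (cdf m[|Ioo a b]) (cdf m'[|Ioo c d])) =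
      volume[|Ico (0 : ℝ) 1 ×ˢ Ico (0 : ℝ) 1] := by
  have := h.isAveragingSet.isProbabilityMeasure_cond
  have := h'.isAveragingSet.isProbabilityMeasure_cond
  rw [cond_prod h.isAveragingSet, ← Measure.map_prod_map _ _ (monotone_cdf _).measurable
    (monotone_cdf _).measurable, map_cdf, map_cdf, Measure.prod_restrict, ProbabilityTheory.cond]
  simp [Measure.volume_eq_prod]

/-- The labels of the dyadic cells of the unit square, pulled back by the distribution functions of
the normalised restrictions of `m` and `m'` to `(a, b)` and `(c, d)`. -/
def equalMassLabel (m m' : Measure ℝ) (a b c d : ℝ) (n : ℕ) : ℝ × ℝ → ℤ × ℤ :=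
  dyadicLabel n ∘ Prod.map (cdf m[|Ioo a b]) (cdf m'[|Ioo c d])

lemma isRegularGrid_equalMassLabel [SFinite m] [SFinite m'] (h : IsChargedInterval m a b)
    (h' : IsChargedInterval m' c d) :
    IsRegularGrid (m.prod m') (Ioo a b ×ˢ Ioo c d) 4 (equalMassLabel m m' a b c d) :=
  isRegularGrid_dyadicLabel.comap (h.isAveragingSet.prod h'.isAveragingSet)
    ((monotone_cdf _).measurable.prodMap (monotone_cdf _).measurable)
    (h.mapsTo_cdf.prodMap h'.mapsTo_cdf)
    ((h.strictMonoOn_cdf.injOn.mono Ioo_subset_Icc_self).prodMap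
      (h'.strictMonoOn_cdf.injOn.mono Ioo_subset_Icc_self))
    (map_cond_prodMap_cdf h h')

lemma exists_inter_preimage_cdf_dyadicIco_ae_eq (h : IsChargedInterval m a b) (n : ℕ) {x : ℝ}
    (hx : x ∈ Ioo a b) : ∃ s t, a ≤ s ∧ s < t ∧ t ≤ b ∧
      (Ioo a b ∩ cdf m[|Ioo a b] ⁻¹' dyadicIco n ⌊2 ^ n * cdf m[|Ioo a b] x⌋ : Set ℝ) =ᵐ[m]
        Ioo s t := by
  have hlt : (⌊2 ^ n * cdf m[|Ioo a b] x⌋ : ℝ) / 2 ^ n <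
      (⌊2 ^ n * cdf m[|Ioo a b] x⌋ + 1) / 2 ^ n := by
    gcongr
    exact lt_add_one _
  obtain ⟨h0, h1⟩ := (Ico_subset_Ico_iff hlt).1 (dyadicIco_subset (n := n) (h.mapsTo_cdf hx))
  exact h.exists_inter_preimage_cdf_ae_eq h0 hlt h1

theorem exists_cell_equalMassLabel_ae_eq (h : IsChargedInterval m a b)
    (h' : IsChargedInterval m' c d) (n : ℕ) {x : ℝ × ℝ} (hx : x ∈ Ioo a b ×ˢ Ioo c d) :
    ∃ s t u v, a ≤ s ∧ s < t ∧ t ≤ b ∧ c ≤ u ∧ u < v ∧ v ≤ d ∧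
      cell (Ioo a b ×ˢ Ioo c d) (equalMassLabel m m' a b c d) n x =ᵐ[m.prod m']
        Ioo s t ×ˢ Ioo u v := by
  obtain ⟨s, t, has, hst, htb, hae⟩ := exists_inter_preimage_cdf_dyadicIco_ae_eq h n hx.1
  obtain ⟨u, v, hcu, huv, hvd, hae'⟩ := exists_inter_preimage_cdf_dyadicIco_ae_eq h' n hx.2
  refine ⟨s, t, u, v, has, hst, htb, hcu, huv, hvd, ?_⟩
  have hcell : cell (Ioo a b ×ˢ Ioo c d) (equalMassLabel m m' a b c d) n x =
      (Ioo a b ∩ cdf m[|Ioo a b] ⁻¹' dyadicIco n ⌊2 ^ n * cdf m[|Ioo a b] x.1⌋) ×ˢ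
        (Ioo c d ∩ cdf m'[|Ioo c d] ⁻¹' dyadicIco n ⌊2 ^ n * cdf m'[|Ioo c d] x.2⌋) := by
    rw [cell, equalMassLabel, preimage_comp, preimage_dyadicLabel, preimage_prod_map_prod,
      prod_inter_prod]
    rfl
  rw [hcell]
  exact Measure.set_prod_ae_eq hae hae'

end Product

end Hardy

namespace Bessel

open Hardy

section Rectangle

variable {lam a b : ℝ} {R : Set (ℝ × ℝ)}

instance : SFinite (measure lam) := by
  unfold measure; infer_instance

instance : NullSingletonClass (measure lam) := by
  unfold measure; infer_instance

lemma isAveragingSet_Ioo (hlam : -(1 / 2) < lam) (ha : 0 ≤ a) (hab : a < b) :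
    IsAveragingSet (measure lam) (Ioo a b) := by
  have happly : measure lam (Ioo a b) = ∫⁻ x in Ioo a b, ENNReal.ofReal (x ^ (2 * lam)) := by
    rw [measure, withDensity_apply _ measurableSet_Ioo,
      Measure.restrict_restrict measurableSet_Ioo,
      inter_eq_left.2 fun x hx => mem_Ioi.2 (ha.trans_lt hx.1)]
  refine ⟨measurableSet_Ioo, ?_, ?_⟩ <;> rw [happly]
  · refine ((setLIntegral_pos_iff (by fun_prop)).2 ?_).ne'
    refine (show 0 < volume (Ioo a b) by simpa using hab).trans_le (measure_mono fun x hx => ?_)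
    exact ⟨(ENNReal.ofReal_pos.2 (Real.rpow_pos_of_pos (ha.trans_lt hx.1) _)).ne', hx⟩
  · have hrpow := (intervalIntegral.integrableOn_Ioo_rpow_iff (ha.trans_lt hab)).2
      (show -1 < 2 * lam by linarith)
    exact (hrpow.mono_set (Ioo_subset_Ioo_left ha)).lintegral_lt_top.ne

lemma isChargedInterval (hlam : -(1 / 2) < lam) (ha : 0 ≤ a) (hab : a < b) :
    IsChargedInterval (measure lam) a b :=
  ⟨hab, fun _ _ has hst _ => isAveragingSet_Ioo hlam (ha.trans has) hst⟩

lemma interval_eq_Ioo (x t : ℝ) : interval x t = Ioo (max (x - t) 0) (x + t) := by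
  ext y
  simp only [interval, mem_inter_iff, mem_Ioo, mem_Ioi, max_lt_iff, and_right_comm]

lemma isRectangle_iff :
    IsRectangle R ↔ ∃ a b c d : ℝ, 0 ≤ a ∧ a < b ∧ 0 ≤ c ∧ c < d ∧ R = Ioo a b ×ˢ Ioo c d := by
  constructor
  · rintro ⟨x₁, t₁, x₂, t₂, hx₁, ht₁, hx₂, ht₂, rfl⟩
    refine ⟨_, _, _, _, le_max_right _ _, ?_, le_max_right _ _, ?_,
      congrArg₂ _ (interval_eq_Ioo x₁ t₁) (interval_eq_Ioo x₂ t₂)⟩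
    all_goals exact max_lt (by linarith) (by linarith)
  · rintro ⟨a, b, c, d, ha, hab, hc, hcd, rfl⟩
    have hinterval {s t : ℝ} (hs : 0 ≤ s) : Ioo s t = interval ((s + t) / 2) ((t - s) / 2) := by
      rw [interval_eq_Ioo, show (s + t) / 2 - (t - s) / 2 = s by ring, max_eq_left hs,
        show (s + t) / 2 + (t - s) / 2 = t by ring]
    refine ⟨_, _, _, _, ?_, ?_, ?_, ?_, congrArg₂ _ (hinterval ha) (hinterval hc)⟩
    all_goals linarith

lemma IsRectangle.isAveragingSet (hlam : -(1 / 2) < lam) (hR : IsRectangle R) :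
    IsAveragingSet (prodMeasure lam) R := by
  obtain ⟨a, b, c, d, ha, hab, hc, hcd, rfl⟩ := isRectangle_iff.1 hR
  exact (isAveragingSet_Ioo hlam ha hab).prod (isAveragingSet_Ioo hlam hc hcd)

lemma IsRectangle.exists_isRegularGrid (hlam : -(1 / 2) < lam) (hR : IsRectangle R) :
    ∃ π : ℕ → ℝ × ℝ → ℤ × ℤ, IsRegularGrid (prodMeasure lam) R 4 π ∧
      ∀ n, ∀ x ∈ R, ∃ R', IsRectangle R' ∧ cell R π n x =ᵐ[prodMeasure lam] R' := by
  obtain ⟨a, b, c, d, ha, hab, hc, hcd, rfl⟩ := isRectangle_iff.1 hR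
  have h₁ := isChargedInterval hlam ha hab
  have h₂ := isChargedInterval hlam hc hcd
  refine ⟨_, isRegularGrid_equalMassLabel h₁ h₂, fun n x hx => ?_⟩
  obtain ⟨s, t, u, v, has, hst, -, hcu, huv, -, hcell⟩ :=
    exists_cell_equalMassLabel_ae_eq h₁ h₂ n hx
  exact ⟨_, isRectangle_iff.2 ⟨s, t, u, v, ha.trans has, hst, hc.trans hcu, huv, rfl⟩, hcell⟩

end Rectangle

section LittleHardy

variable {lam c t : ℝ} {q : ℝ≥0∞} {f : Lp ℂ 1 (prodMeasure lam)} {α : ℕ → ℂ}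
  {a : ℕ → ℝ × ℝ → ℂ} {u : ℕ → Lp ℂ 1 (prodMeasure lam)}

/-- The classes in `L¹` of the `q`-atoms. -/
abbrev rectangleAtoms (lam : ℝ) (q : ℝ≥0∞) : Set (Lp ℂ 1 (prodMeasure lam)) :=
  atoms ℂ (prodMeasure lam) q {R | IsRectangle R}

lemma isAtom_iff (hlam : -(1 / 2) < lam) {a : ℝ × ℝ → ℂ} : IsAtom lam q a ↔
    ∃ R, IsRectangle R ∧
      IsAtomOfHeight (prodMeasure lam) q R (prodMeasure lam R)⁻¹.toNNReal a := by
  constructor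
  · rintro ⟨hmem, ⟨R, hR, hzero, hnorm⟩, hmean⟩
    exact ⟨R, hR, (isAtomOfHeight_inv_measure_iff (hR.isAveragingSet hlam)).2
      ⟨hmem, hzero, hnorm, hmean⟩⟩
  · rintro ⟨R, hR, h⟩
    obtain ⟨hmem, hzero, hnorm, hmean⟩ :=
      (isAtomOfHeight_inv_measure_iff (hR.isAveragingSet hlam)).1 h
    exact ⟨hmem, ⟨R, hR, hzero, hnorm⟩, hmean⟩

lemma tendsto_sum_range_iff (hu : ∀ i, u i =ᵐ[prodMeasure lam] a i) :
    Tendsto (fun n => ∑ i ∈ Finset.range n, α i • u i) atTop (𝓝 f) ↔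
      Tendsto (fun n => eLpNorm (fun x => f x - ∑ i ∈ Finset.range n, α i * a i x) 1
        (prodMeasure lam)) atTop (𝓝 0) := by
  rw [Lp.tendsto_Lp_iff_tendsto_eLpNorm']
  refine tendsto_congr fun n => ?_
  rw [eLpNorm_sub_comm]
  refine eLpNorm_congr_ae ?_
  filter_upwards [Lp.coeFn_fun_finsetSum (Finset.range n) fun i => α i • u i, ae_all_iff.2 hu,
    ae_all_iff.2 fun i => Lp.coeFn_smul (α i) (u i)] with x hx hux hsx
  simp only [Pi.sub_apply, hx, hsx, Pi.smul_apply, hux, smul_eq_mul]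

lemma norm_le_one_of_mem_rectangleAtoms (hlam : -(1 / 2) < lam) (hq : 1 ≤ q) :
    ∀ u ∈ rectangleAtoms lam q, ‖u‖ ≤ 1 :=
  fun _ => norm_le_one_of_mem_atoms (fun _ hR => hR.isAveragingSet hlam) hq

lemma isAtomicSum_rectangleAtoms_iff (hlam : -(1 / 2) < lam) (hq : 1 ≤ q) :
    IsAtomicSum ℂ (rectangleAtoms lam q) c f ↔
      ∃ α a, IsAtomicDecomposition lam q f α a ∧ ∑' i, ‖α i‖ ≤ c := by
  have hbound := norm_le_one_of_mem_rectangleAtoms hlam hq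
  have hne : (rectangleAtoms lam q).Nonempty :=
    ⟨0, interval 1 1 ×ˢ interval 1 1, ⟨1, 1, 1, 1, by simp⟩,
      IsAtomOfHeight.zero.congr (Lp.coeFn_zero _ _ _).symm⟩
  rw [isAtomicSum_iff_exists_nat hbound hne]
  constructor
  · rintro ⟨α, u, hu, hα, hc, hf⟩
    exact ⟨α, fun i => u i, ⟨fun i => (isAtom_iff hlam).2 (hu i), hα,
      (tendsto_sum_range_iff fun i => ae_eq_refl _).1 hf.tendsto_sum_nat⟩, hc⟩
  · rintro ⟨α, a, ⟨ha, hα, hlim⟩, hc⟩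
    choose R hR ha using fun i => (isAtom_iff hlam).1 (ha i)
    have hmem i : MemLp (a i) 1 (prodMeasure lam) :=
      (ha i).memLp_one ((hR i).isAveragingSet hlam) hq
    have hu i : (hmem i).toLp (a i) ∈ rectangleAtoms lam q :=
      ⟨R i, hR i, (ha i).congr (hmem i).coeFn_toLp.symm⟩
    have hsum : Summable fun i => α i • (hmem i).toLp (a i) :=
      .of_norm_bounded hα fun i => by
        rw [norm_smul]
        exact mul_le_of_le_one_right (norm_nonneg _) (hbound _ (hu i))
    exact ⟨α, _, hu, hα, hc, hsum.hasSum_iff_tendsto_nat.2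
      ((tendsto_sum_range_iff fun i => (hmem i).coeFn_toLp).2 hlim)⟩

lemma mem_littleHardy_iff (hlam : -(1 / 2) < lam) (hq : 1 ≤ q) :
    f ∈ littleHardy lam q ↔ ∃ c, IsAtomicSum ℂ (rectangleAtoms lam q) c f := by
  simp only [littleHardy, mem_ofPred_eq, isAtomicSum_rectangleAtoms_iff hlam hq]
  exact ⟨fun ⟨α, a, h⟩ => ⟨_, α, a, h, le_rfl⟩, fun ⟨_, α, a, h, _⟩ => ⟨α, a, h⟩⟩

lemma littleHardyNorm_le (hlam : -(1 / 2) < lam) (hq : 1 ≤ q)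
    (h : IsAtomicSum ℂ (rectangleAtoms lam q) c f) : littleHardyNorm lam q f ≤ c := by
  obtain ⟨α, a, h, hc⟩ := (isAtomicSum_rectangleAtoms_iff hlam hq).1 h
  refine le_trans (csInf_le ⟨0, ?_⟩ ⟨α, a, h, rfl⟩ : littleHardyNorm lam q f ≤ _) hc
  rintro s ⟨α, a, -, rfl⟩
  exact tsum_nonneg fun i => norm_nonneg _

lemma le_littleHardyNorm (hlam : -(1 / 2) < lam) (hq : 1 ≤ q) (hf : f ∈ littleHardy lam q)
    (h : ∀ c, IsAtomicSum ℂ (rectangleAtoms lam q) c f → t ≤ c) :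
    t ≤ littleHardyNorm lam q f := by
  obtain ⟨α, a, hd⟩ := hf
  refine le_csInf ⟨_, α, a, hd, rfl⟩ ?_
  rintro s ⟨α, a, hd, rfl⟩
  exact h _ ((isAtomicSum_rectangleAtoms_iff hlam hq).2 ⟨α, a, hd, le_rfl⟩)

lemma isAtomicSum_of_isAtomicSum_top (hlam : -(1 / 2) < lam) (hq : 1 ≤ q)
    (h : IsAtomicSum ℂ (rectangleAtoms lam ∞) c f) : IsAtomicSum ℂ (rectangleAtoms lam q) c f :=
  h.mono (norm_le_one_of_mem_rectangleAtoms hlam hq)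
    (atoms_subset_of_exponent_le (fun _ hR => hR.isAveragingSet hlam) le_top)

lemma exists_isAtomicSum_top (hlam : -(1 / 2) < lam) (hq : 1 < q) (hq' : q ≠ ∞) :
    ∃ C : ℝ, 0 < C ∧ ∀ c f, IsAtomicSum ℂ (rectangleAtoms lam q) c f →
      IsAtomicSum ℂ (rectangleAtoms lam ∞) (C * c) f :=
  exists_isAtomicSum_top_of_isRegularGrid (by norm_num : (1 : NNReal) ≤ 4) hq hq'
    (fun _ hR => hR.isAveragingSet hlam) fun _ hR => hR.exists_isRegularGrid hlam

end LittleHardy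

end Bessel

end

theorem mainTheorem8_general (lam : ℝ) (hlam : -(1 / 2) < lam) (q : ℝ≥0∞) (hq : 1 < q)
    (hq' : q < ∞) :
    Bessel.littleHardy lam q = Bessel.littleHardy lam ∞ ∧
    ∃ c C : ℝ, 0 < c ∧ 0 < C ∧ ∀ f ∈ Bessel.littleHardy lam ∞,
      c * Bessel.littleHardyNorm lam ∞ f ≤ Bessel.littleHardyNorm lam q f ∧
      Bessel.littleHardyNorm lam q f ≤ C * Bessel.littleHardyNorm lam ∞ f := by
  obtain ⟨C, hC, htop⟩ := Bessel.exists_isAtomicSum_top hlam hq hq'.ne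
  have heq : Bessel.littleHardy lam q = Bessel.littleHardy lam ∞ := by
    ext f
    rw [Bessel.mem_littleHardy_iff hlam hq.le, Bessel.mem_littleHardy_iff hlam le_top]
    exact ⟨fun ⟨c, hc⟩ => ⟨_, htop c f hc⟩,
      fun ⟨c, hc⟩ => ⟨c, Bessel.isAtomicSum_of_isAtomicSum_top hlam hq.le hc⟩⟩
  refine ⟨heq, C⁻¹, 1, inv_pos.2 hC, one_pos, fun f hf => ⟨?_, ?_⟩⟩
  · refine Bessel.le_littleHardyNorm hlam hq.le (heq ▸ hf) fun c hc => ?_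
    rw [inv_mul_le_iff₀ hC]
    exact Bessel.littleHardyNorm_le hlam le_top (htop c f hc)
  · rw [one_mul]
    exact Bessel.le_littleHardyNorm hlam le_top hf fun c hc =>
      Bessel.littleHardyNorm_le hlam hq.le (Bessel.isAtomicSum_of_isAtomicSum_top hlam hq.le hc)

theorem mainTheorem8 (lam : ℝ) (hlam : 0 < lam) (q : ℝ≥0∞) (hq : 1 < q) (hq' : q < ∞) :
    Bessel.littleHardy lam q = Bessel.littleHardy lam ∞ ∧
    ∃ c C : ℝ, 0 < c ∧ 0 < C ∧ ∀ f ∈ Bessel.littleHardy lam ∞,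
      c * Bessel.littleHardyNorm lam ∞ f ≤ Bessel.littleHardyNorm lam q f ∧
      Bessel.littleHardyNorm lam q f ≤ C * Bessel.littleHardyNorm lam ∞ f :=
  mainTheorem8_general lam (by linarith) q hq hq'
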